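/- A \emph{transaction} is a finite set of operations, each a read $\mathsf{read}_i(x,v)$ or a write $\mathsf{write}_i(x,v)$ of a value $v$ from/to a variable $x$ with an identifier $i$, together with a strict total order (program order); it contains at most one write to each variable, and no read of a variable is preceded by a write to the same variable. A \emph{history} $h=\langle T,\mathsf{so},\mathsf{wr}\rangle$ consists of a finite family $T$ of transactions, a strict partial order $\mathsf{so}$ on $T$ (session order) and a relation $\mathsf{wr}$ between transactions and the read operations of $T$ (write-read relation) such that every read operation is related to exactly one transaction, $(t,\mathsf{read}_i(x,v))\in\mathsf{wr}$ implies that $t$ contains a write of $v$ to $x$, and $\mathsf{so}\cup\mathsf{wr}$ is acyclic; moreover some transaction (the initial one) writes all variables occurring in $h$ and precedes all other transactions in $\mathsf{so}$. Here $(t_1,t_2)\in\mathsf{wr}_x$ means that $(t_1,o)\in\mathsf{wr}$ for some read $o$ of $x$ in $t_2$, and, between transactions, $\mathsf{wr}=\bigcup_x\mathsf{wr}_x$. The \emph{width} of $h$ is the maximum number of transactions that are mutually unordered by $\mathsf{so}$. A history \emph{satisfies snapshot isolation} if there is a strict total order $\mathsf{co}$ on $T$ with $\mathsf{wr}\cup\mathsf{so}\subseteq\mathsf{co}$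 such that, for all variables $x$ and all transactions $t_1\ne t_2$ and $t_3$ with $(t_1,t_3)\in\mathsf{wr}_x$ and $t_2$ writing $x$: \begin{itemize} \item (Prefix) if $(t_2,t_4)\in\mathsf{co}^*$ and $(t_4,t_3)\in\mathsf{wr}\cup\mathsf{so}$ for some $t_4$, then $(t_2,t_1)\in\mathsf{co}$; \item (Conflict) if $(t_2,t_4)\in\mathsf{co}^*$ and $(t_4,t_3)\in\mathsf{co}$ for some $t_4$ such that $t_3$ and $t_4$ write a common variable, then $(t_2,t_1)\in\mathsf{co}$. \end{itemize} \textbf{Corollary.} For an arbitrary but fixed constant $k\in\mathbb N$, the problem of checking, given a history of width at most $k$, whether it satisfies snapshot isolation is solvable in polynomial time (in the size of the history). -/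

import Mathlib

/-- Operations: `read i x v` reads the value `v` from the variable `x`, `write i x v` writes the
value `v` to the variable `x`; `i` is the operation identifier.  Identifiers, variables and values
are named by natural numbers. -/
inductive Op where
  | read (i x v : ℕ)
  | write (i x v : ℕ)

/-- The variable accessed by an operation. -/
def Op.var : Op → ℕ
  | .read _ x _ => x
  | .write _ x _ => x

/-- A transaction: a finite set of operations with a strict total order (program order), given as
the duplicate-free list of its operations in program order.  It has at most one write to each
variable, and no read of a variable is preceded by a write to the same variable. -/
structure Transaction where
  ops : List Op
  nodup : ops.Nodup
  write_unique : ∀ i j x v w, Op.write i x v ∈ ops → Op.write j x w ∈ ops → i = j ∧ v = w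
  no_read_after_write :
    ops.Pairwise fun a b => ¬ ∃ i j x v w, a = Op.write i x v ∧ b = Op.read j x w

/-- The transaction writes the variable `x`. -/
def Transaction.Writes (t : Transaction) (x : ℕ) : Prop :=
  ∃ i v, Op.write i x v ∈ t.ops

/-- The raw data of a history: finitely many transactions (named by `Fin n`), a relation `so` on
them, and a relation `wr` between transactions and operations. -/
structure PreHistory where
  n : ℕ
  tx : Fin n → Transaction
  so : Fin n → Fin n → Prop
  wr : Fin n → Op → Prop

namespace PreHistory

/-- `wr_x`, extended to pairs of transactions. -/
def wrVar (h : PreHistory) (x : ℕ) (t₁ t₂ : Fin h.n) : Prop :=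
  ∃ i v, Op.read i x v ∈ (h.tx t₂).ops ∧ h.wr t₁ (Op.read i x v)

/-- `wr`, extended to pairs of transactions. -/
def wrTx (h : PreHistory) (t₁ t₂ : Fin h.n) : Prop :=
  ∃ x, h.wrVar x t₁ t₂

/-- The operation `o` is a read operation of some transaction. -/
def IsReadOp (h : PreHistory) (o : Op) : Prop :=
  ∃ t i x v, o = Op.read i x v ∧ o ∈ (h.tx t).ops

/-- The variable `x` is accessed by some operation. -/
def Accesses (h : PreHistory) (x : ℕ) : Prop :=
  ∃ t, ∃ o ∈ (h.tx t).ops, o.var = x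

end PreHistory

/-- A history: the session order `so` is a strict partial order; the write-read relation `wr`
relates transactions to read operations, its inverse is a total function, a read of `v` from `x`
is related to a transaction that writes `v` to `x`, and `so ∪ wr` is acyclic.  There is an initial
transaction that writes all variables and precedes all other transactions in session order. -/
structure History extends PreHistory where
  so_irrefl : ∀ t, ¬ so t t
  so_trans : ∀ t₁ t₂ t₃, so t₁ t₂ → so t₂ t₃ → so t₁ t₃
  wr_isReadOp : ∀ t o, wr t o → toPreHistory.IsReadOp o
  wr_inv_total : ∀ o, toPreHistory.IsReadOp o → ∃! t, wr t o
  wr_writes : ∀ t i x v, wr t (Op.read i x v) → ∃ j, Op.write j x v ∈ (tx t).ops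
  acyclic : ∀ t, ¬ Relation.TransGen (fun t₁ t₂ => so t₁ t₂ ∨ toPreHistory.wrTx t₁ t₂) t t
  init : ∃ t₀, (∀ t, t ≠ t₀ → so t₀ t) ∧ ∀ x, toPreHistory.Accesses x → (tx t₀).Writes x

namespace History

open Classical in
/-- The width: the maximum number of mutually unordered transactions in session order. -/
noncomputable def width (h : History) : ℕ :=
  (Finset.univ.filter fun s : Finset (Fin h.n) => IsAntichain h.so (s : Set (Fin h.n))).sup
    Finset.card

/-- The axiom Prefix for a history and a commit order. -/
def PrefixAxiom (h : History) (co : Fin h.n → Fin h.n → Prop) : Prop :=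
  ∀ x t₁ t₂ t₃, t₁ ≠ t₂ → h.wrVar x t₁ t₃ → (h.tx t₂).Writes x →
    (∃ t₄, Relation.ReflTransGen co t₂ t₄ ∧ (h.wrTx t₄ t₃ ∨ h.so t₄ t₃)) →
    co t₂ t₁

/-- The axiom Conflict for a history and a commit order. -/
def ConflictAxiom (h : History) (co : Fin h.n → Fin h.n → Prop) : Prop :=
  ∀ x t₁ t₂ t₃ t₄ y, t₁ ≠ t₂ → h.wrVar x t₁ t₃ → (h.tx t₂).Writes x →
    (h.tx t₃).Writes y → (h.tx t₄).Writes y →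
    Relation.ReflTransGen co t₂ t₄ → co t₄ t₃ →
    co t₂ t₁

/-- Snapshot isolation: some commit order (a strict total order on the transactions that contains
the write-read relation and the session order) satisfies Prefix and Conflict. -/
def SnapshotIsolation (h : History) : Prop :=
  ∃ co : Fin h.n → Fin h.n → Prop, IsStrictTotalOrder (Fin h.n) co ∧
    (∀ t₁ t₂, h.wrTx t₁ t₂ ∨ h.so t₁ t₂ → co t₁ t₂) ∧
    h.PrefixAxiom co ∧ h.ConflictAxiom co

end History

/-- An operation as four numbers: kind, identifier, variable, value. -/
def Op.code : Op → List ℕ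
  | .read i x v => [0, i, x, v]
  | .write i x v => [1, i, x, v]

namespace History

/-- The total number of (occurrences of) operations in the transactions of the history. -/
def numOps (h : History) : ℕ :=
  ((List.finRange h.n).map fun t => (h.tx t).ops.length).sum

open Classical in
/-- The matrix of the session order, row by row. -/
noncomputable def soCode (h : History) : List ℕ :=
  (List.finRange h.n).flatMap fun t₁ =>
    (List.finRange h.n).map fun t₂ => if h.so t₁ t₂ then 1 else 0

open Classical in
/-- The record of an operation `o` of the transaction `t`: the index of `t`, the operation, and
for every transaction `t'` whether `t'` is related to `o` by the write-read relation. -/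
noncomputable def opRecord (h : History) (t : Fin h.n) (o : Op) : List ℕ :=
  (t : ℕ) :: (o.code ++ (List.finRange h.n).map fun t' => if h.wr t' o then 1 else 0)

/-- A history as a list of numbers: the number of transactions, the number of operations, the
session order, and the records of all operations, transaction by transaction in program order. -/
noncomputable def encode (h : History) : List ℕ :=
  h.n :: h.numOps :: (h.soCode ++
    (List.finRange h.n).flatMap fun t => (h.tx t).ops.flatMap fun o => h.opRecord t o)

end History

namespace RAM

/-- The state of a random access machine: registers and memory cells, holding natural numbers. -/
structure State where
  reg : ℕ → ℕ
  mem : ℕ → ℕ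

/-- Assignment of `v` to the register `d`. -/
def State.setReg (s : State) (d v : ℕ) : State :=
  { s with reg := Function.update s.reg d v }

/-- Assignment of `v` to the memory cell with address `a`. -/
def State.setMem (s : State) (a v : ℕ) : State :=
  { s with mem := Function.update s.mem a v }

/-- Programs of the random access machine.  Multiplication is not an instruction, so that the
bit length of the numbers grows by at most one per step. -/
inductive Prog where
  /-- do nothing -/
  | skip
  /-- `R[d] := c` -/
  | const (d c : ℕ)
  /-- `R[d] := R[a]` -/
  | copy (d a : ℕ)
  /-- `R[d] := R[a] + R[b]` -/
  | add (d a b : ℕ)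
  /-- `R[d] := max (R[a] - R[b]) 0` -/
  | sub (d a b : ℕ)
  /-- `R[d] := M[R[a]]` -/
  | load (d a : ℕ)
  /-- `M[R[a]] := R[b]` -/
  | store (a b : ℕ)
  /-- `p; q` -/
  | seq (p q : Prog)
  /-- `if R[a] ≠ 0 then p else q` -/
  | ite (a : ℕ) (p q : Prog)
  /-- `while R[a] ≠ 0 do p` -/
  | loop (a : ℕ) (p : Prog)

/-- `Run p s t s'`: started in state `s`, the program `p` halts in state `s'` after exactly `t`
steps.  Every elementary instruction and every evaluation of a test is one step. -/
inductive Run : Prog → State → ℕ → State → Prop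
  | skip (s : State) : Run .skip s 1 s
  | const (d c : ℕ) (s : State) : Run (.const d c) s 1 (s.setReg d c)
  | copy (d a : ℕ) (s : State) : Run (.copy d a) s 1 (s.setReg d (s.reg a))
  | add (d a b : ℕ) (s : State) : Run (.add d a b) s 1 (s.setReg d (s.reg a + s.reg b))
  | sub (d a b : ℕ) (s : State) : Run (.sub d a b) s 1 (s.setReg d (s.reg a - s.reg b))
  | load (d a : ℕ) (s : State) : Run (.load d a) s 1 (s.setReg d (s.mem (s.reg a)))
  | store (a b : ℕ) (s : State) : Run (.store a b) s 1 (s.setMem (s.reg a) (s.reg b))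
  | seq {p q : Prog} {s s' s'' : State} {t t' : ℕ} :
      Run p s t s' → Run q s' t' s'' → Run (.seq p q) s (t + t') s''
  | ite_true {a : ℕ} {p : Prog} (q : Prog) {s s' : State} {t : ℕ} :
      s.reg a ≠ 0 → Run p s t s' → Run (.ite a p q) s (t + 1) s'
  | ite_false {a : ℕ} (p : Prog) {q : Prog} {s s' : State} {t : ℕ} :
      s.reg a = 0 → Run q s t s' → Run (.ite a p q) s (t + 1) s'
  | loop_step {a : ℕ} {p : Prog} {s s' s'' : State} {t t' : ℕ} :
      s.reg a ≠ 0 → Run p s t s' → Run (.loop a p) s' t' s'' →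
      Run (.loop a p) s (t + t' + 1) s''
  | loop_exit {a : ℕ} (p : Prog) {s : State} :
      s.reg a = 0 → Run (.loop a p) s 1 s

/-- The initial state on input `l`: the length of `l` in register `0`, the entries of `l` in the
memory cells `0, 1, …, l.length - 1`, and `0` everywhere else. -/
def initState (l : List ℕ) : State where
  reg := fun i => if i = 0 then l.length else 0
  mem := fun i => l.getD i 0

/-- The size of an input in bits (with one separator for each number). -/
def bitSize (l : List ℕ) : ℕ :=
  (l.map fun a => Nat.size a + 1).sum

/-- The decision problem `P` on instances of type `α`, presented to the machine through `enc`, is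
solvable in polynomial time: one program, on every instance, halts within a number of steps that
is polynomial in the size of the input, and answers (in register `0`) whether `P` holds. -/
def PolyTimeDecidable {α : Type*} (enc : α → List ℕ) (P : α → Prop) : Prop :=
  ∃ (prog : Prog) (p : Polynomial ℕ), ∀ a : α, ∃ (t : ℕ) (s : State),
    Run prog (initState (enc a)) t s ∧ t ≤ p.eval (bitSize (enc a)) ∧ (s.reg 0 ≠ 0 ↔ P a)

end RAM

/-! Snapshot isolation has an operational reading. Split every transaction into a snapshot event and
a commit event. A snapshot requires that all predecessors in `so ∪ wr` are committed. A commit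
requires that nobody still has to read a version that it overwrites, and that no other active
transaction writes a common variable. An execution of all `2n` events yields the commit order as
`co`. Conversely, given `co`, transactions are committed in this order and every snapshot is taken
as soon as the events that have to precede it are done; Prefix and Conflict say precisely that no
commit is then blocked. Hence snapshot isolation means that the full set of events is reachable from
`∅` (`snapshotIsolation_iff`).

Whether an event may happen depends only on the set of events so far, so it suffices to search the
graph of reachable sets. This graph is small. The committed transactions are closed downwards in
`so`, hence determined by their maximal elements, an antichain. The active transactions form an
antichain too, since the `so`-predecessors of an active transaction are committed. Two antichains of
size at most `k` leave at most `(n + 1) ^ (2 * k)` reachable sets (`card_reachable_le`).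

The search must run on the machine. It is written in a small language whose loop bounds sit in
registers that the program never changes; such programs compile to machine programs with a
polynomial time bound that is read off the syntax (`Cmd.compile_run`). Tests are terms in which
bounded quantifiers are sums. A table of bit vectors serves both as the list of sets found and as
the queue of the search (`exec_searchCmd`). -/

/-! ### Compilation of terms with bounded sums -/

namespace RAM

/-- Arithmetic terms over registers and memory; `sum r b e` is the sum of the values of `e` for
`R[r] = 0, …, R[b] - 1`. -/
inductive Tm where
  | reg (r : ℕ)
  | const (c : ℕ)
  | add (e f : Tm)
  | sub (e f : Tm)
  | load (e : Tm)
  | sum (r b : ℕ) (e : Tm)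

namespace Tm

/-- The value of a term. -/
def eval : Tm → (ℕ → ℕ) → (ℕ → ℕ) → ℕ
  | reg r, ρ, _ => ρ r
  | const c, _, _ => c
  | add e f, ρ, m => e.eval ρ m + f.eval ρ m
  | sub e f, ρ, m => e.eval ρ m - f.eval ρ m
  | load e, ρ, m => m (e.eval ρ m)
  | sum r b e, ρ, m => ∑ i ∈ Finset.range (ρ b), e.eval (Function.update ρ r i) m

/-- All registers of the term are below `D`, the bounds of sums are below `κ`, and the summation
registers are not. -/
def WF (κ D : ℕ) : Tm → Prop
  | reg r => r < D
  | const _ => True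
  | add e f => e.WF κ D ∧ f.WF κ D
  | sub e f => e.WF κ D ∧ f.WF κ D
  | load e => e.WF κ D
  | sum r b e => κ ≤ r ∧ r < D ∧ b < κ ∧ b < D ∧ e.WF κ D

instance decidableWF (κ D : ℕ) : (e : Tm) → Decidable (e.WF κ D)
  | reg r => inferInstanceAs (Decidable (r < D))
  | const _ => inferInstanceAs (Decidable True)
  | add e f => @instDecidableAnd _ _ (decidableWF κ D e) (decidableWF κ D f)
  | sub e f => @instDecidableAnd _ _ (decidableWF κ D e) (decidableWF κ D f)
  | load e => decidableWF κ D e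
  | sum r b e =>
    have := decidableWF κ D e
    inferInstanceAs (Decidable (κ ≤ r ∧ r < D ∧ b < κ ∧ b < D ∧ e.WF κ D))

/-- The program that computes a term into the register `d`, using only registers from `d` on as
scratch space. -/
def compile : Tm → ℕ → Prog
  | reg r, d => .copy d r
  | const c, d => .const d c
  | add e f, d => .seq (e.compile d) (.seq (f.compile (d + 1)) (.add d d (d + 1)))
  | sub e f, d => .seq (e.compile d) (.seq (f.compile (d + 1)) (.sub d d (d + 1)))
  | load e, d => .seq (e.compile d) (.load d d)
  | sum r b e, d =>
    .seq (.copy d b) <| .seq (.copy (d + 1) r) <| .seq (.const (d + 2) 0) <| .seq (.const r 0) <|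
    .seq (.loop d <|
      .seq (e.compile (d + 3)) <| .seq (.add (d + 2) (d + 2) (d + 3)) <|
      .seq (.const (d + 3) 1) <| .seq (.add r r (d + 3)) (.sub d d (d + 3))) <|
    .seq (.copy r (d + 1)) (.copy d (d + 2))

/-- A polynomial bound for the time to compute a term, in a bound for the ranges of sums. -/
noncomputable def cost : Tm → Polynomial ℕ
  | reg _ => 1
  | const _ => 1
  | add e f => e.cost + f.cost + 1
  | sub e f => e.cost + f.cost + 1
  | load e => e.cost + 1
  | sum _ _ e => Polynomial.X * (e.cost + 5) + 7

theorem eval_congr {κ D : ℕ} (e : Tm) (he : e.WF κ D) {ρ ρ' : ℕ → ℕ} (h : ∀ r < D, ρ r = ρ' r)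
    (m : ℕ → ℕ) : e.eval ρ m = e.eval ρ' m := by
  induction e generalizing ρ ρ' with
  | reg r => exact h r he
  | const c => rfl
  | add e f ihe ihf => simp only [eval, ihe he.1 h, ihf he.2 h]
  | sub e f ihe ihf => simp only [eval, ihe he.1 h, ihf he.2 h]
  | load e ihe => simp only [eval, ihe he h]
  | sum r b e ihe =>
    obtain ⟨-, -, -, hb, he⟩ := he
    simp only [eval, h b hb]
    refine Finset.sum_congr rfl fun i _ => ihe he fun q hq => ?_
    by_cases hqr : q = r
    · subst hqr; simp
    · simp [hqr, h q hq]

end Tm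

/-- Started in registers whose first `κ` entries are at most `B`, the compiled program of `e`
computes the value of `e` within its cost, for all positions of the scratch space from `D` on. -/
def Tm.Computes (κ D B : ℕ) (e : Tm) : Prop :=
  ∀ d, D ≤ d → ∀ s : State, (∀ q < κ, s.reg q ≤ B) →
    ∃ t s', Run (e.compile d) s t s' ∧ t ≤ e.cost.eval B ∧ s'.mem = s.mem ∧
      (∀ q < d, s'.reg q = s.reg q) ∧ s'.reg d = e.eval s.reg s.mem

/-- Loop invariant for sums: `d` counts the remaining rounds down, `r` counts the index up, `d + 2`
accumulates, and `d + 1` keeps the old value of `r` for restoration. Since `r` is overwritten, the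
registers are compared with the original `ρ` only off `r`. A round costs the body plus four
instructions and one test. -/
theorem Tm.sum_loop_run {κ D d r B C N : ℕ} {e : Tm} {ρ : ℕ → ℕ} (hD : D ≤ d) (hr : r < D)
    (hrκ : κ ≤ r) (hbound : ∀ q < κ, ρ q ≤ B) (he : e.WF κ D)
    (ih : ∀ s : State, (∀ q < κ, s.reg q ≤ B) → ∃ t s', Run (e.compile (d + 3)) s t s' ∧
      t ≤ C ∧ s'.mem = s.mem ∧ (∀ q < d + 3, s'.reg q = s.reg q) ∧
      s'.reg (d + 3) = e.eval s.reg s.mem) (k : ℕ) :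
    ∀ (i : ℕ) (s : State), i + k = N → s.reg d = k → s.reg r = i →
      (∀ q < d, q ≠ r → s.reg q = ρ q) → ∃ t s', Run (.loop d <|
      .seq (e.compile (d + 3)) <| .seq (.add (d + 2) (d + 2) (d + 3)) <|
      .seq (.const (d + 3) 1) <| .seq (.add r r (d + 3)) (.sub d d (d + 3))) s t s' ∧
      t ≤ k * (C + 5) + 1 ∧ s'.mem = s.mem ∧ (∀ q < d, q ≠ r → s'.reg q = ρ q) ∧
      s'.reg (d + 1) = s.reg (d + 1) ∧ s'.reg (d + 2) = s.reg (d + 2) +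
        ∑ j ∈ Finset.Ico i N, e.eval (Function.update ρ r j) s.mem := by
  induction k with
  | zero =>
    intro i s hi hk _ hρ
    refine ⟨1, s, Run.loop_exit _ hk, by simp, rfl, hρ, rfl, ?_⟩
    simp [show N = i by omega]
  | succ k ihk =>
    intro i s hi hk hri hρ
    have hrd : r < d := by omega
    obtain ⟨t₁, s₁, run₁, ht₁, hm₁, hl₁, hv₁⟩ := ih s (fun q hq => by
      rw [hρ q (by omega) (by omega)]; exact hbound q hq)
    have hv : s₁.reg (d + 3) = e.eval (Function.update ρ r i) s.mem := by
      rw [hv₁]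
      refine eval_congr e he (fun q hq => ?_) _
      by_cases hqr : q = r
      · subst hqr; simp [hri]
      · simp [hqr, hρ q (by omega) hqr]
    set s₂ := s₁.setReg (d + 2) (s₁.reg (d + 2) + s₁.reg (d + 3)) with hs₂
    set s₃ := s₂.setReg (d + 3) 1 with hs₃
    set s₄ := s₃.setReg r (s₃.reg r + s₃.reg (d + 3)) with hs₄
    set s₅ := s₄.setReg d (s₄.reg d - s₄.reg (d + 3)) with hs₅
    have hreg : ∀ q, s₅.reg q = if q = d then k else if q = r then i + 1 else
        if q = d + 3 then 1 else if q = d + 2 then s.reg (d + 2) +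
          e.eval (Function.update ρ r i) s.mem else s₁.reg q := by
      intro q
      have h1 := hl₁ d (by omega)
      have h2 := hl₁ r (by omega)
      have h3 := hl₁ (d + 2) (by omega)
      simp only [hs₅, hs₄, hs₃, hs₂, State.setReg, Function.update_apply]
      have e1 : d + 3 ≠ r := by omega
      have e2 : d ≠ r := by omega
      have e3 : r ≠ d + 2 := by omega
      have e4 : r ≠ d + 3 := by omega
      simp only [e1, e2, e3, e4, h1, h2, h3, hk, hri, hv]
      simp
    have hmem : s₅.mem = s.mem := hm₁
    obtain ⟨t', s', run', ht', hm', hl', hd1', hd2'⟩ := ihk (i + 1) s₅ (by omega)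
      (by rw [hreg]; simp) (by rw [hreg, if_neg (by omega)]; simp) (fun q hq hqr => by
        rw [hreg, if_neg (by omega), if_neg hqr, if_neg (by omega), if_neg (by omega),
          hl₁ q (by omega), hρ q hq hqr])
    refine ⟨_, s', Run.loop_step (by omega) (run₁.seq <| (Run.add _ _ _ _).seq <|
      (Run.const _ _ _).seq <| (Run.add _ _ _ _).seq (Run.sub _ _ _ _)) run', ?_,
      hm'.trans hmem, hl', ?_, ?_⟩
    · nlinarith
    · rw [hd1', hreg, if_neg (by omega), if_neg (by omega), if_neg (by omega), if_neg (by omega),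
        hl₁ _ (by omega)]
    · rw [hd2', hreg, if_neg (by omega), if_neg (by omega), if_neg (by omega), if_pos rfl, hmem,
        Finset.sum_eq_sum_Ico_succ_bot (show i < N by omega), add_assoc]

/-- The first operand, kept in `d`, survives because the second is computed with scratch space from
`d + 1` on. Stated for a general `op` to serve both addition and subtraction. -/
theorem Tm.binary_run {κ D B : ℕ} (hκ : κ ≤ D) {e f : Tm} (hf : f.WF κ D)
    (ihe : e.Computes κ D B) (ihf : f.Computes κ D B) (op : ℕ → ℕ → ℕ) (instr : Prog) {d : ℕ}
    (hinstr : ∀ s, Run instr s 1 (s.setReg d (op (s.reg d) (s.reg (d + 1))))) (hD : D ≤ d)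
    (s : State) (hs : ∀ q < κ, s.reg q ≤ B) :
    ∃ t s', Run (.seq (e.compile d) (.seq (f.compile (d + 1)) instr)) s t s' ∧
      t ≤ e.cost.eval B + f.cost.eval B + 1 ∧ s'.mem = s.mem ∧ (∀ q < d, s'.reg q = s.reg q) ∧
      s'.reg d = op (e.eval s.reg s.mem) (f.eval s.reg s.mem) := by
  obtain ⟨t₁, s₁, run₁, ht₁, hm₁, hl₁, hv₁⟩ := ihe d hD s hs
  obtain ⟨t₂, s₂, run₂, ht₂, hm₂, hl₂, hv₂⟩ := ihf (d + 1) (by omega) s₁ (fun q hq => by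
    rw [hl₁ q (by omega)]; exact hs q hq)
  refine ⟨_, _, run₁.seq (run₂.seq (hinstr s₂)), by omega, hm₂.trans hm₁, fun q hq => ?_, ?_⟩
  · simp [State.setReg, hq.ne, hl₂ q (by omega), hl₁ q hq]
  · simp [State.setReg, hl₂ d (by omega), hv₁, hv₂, hm₁,
      f.eval_congr hf (fun q hq => hl₁ q (by omega)) s.mem]

theorem Tm.compile_run {κ D B : ℕ} (hκ : κ ≤ D) (e : Tm) (he : e.WF κ D) :
    e.Computes κ D B := by
  induction e with
  | reg r =>
    exact fun d hd s hs => ⟨1, _, Run.copy _ _ _, by simp [cost], rfl,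
      fun q hq => by simp [State.setReg, hq.ne], by simp [State.setReg, eval]⟩
  | const c =>
    exact fun d hd s hs => ⟨1, _, Run.const _ _ _, by simp [cost], rfl,
      fun q hq => by simp [State.setReg, hq.ne], by simp [State.setReg, eval]⟩
  | add e f ihe ihf =>
    intro d hd s hs
    simpa [cost, eval, compile] using binary_run hκ he.2 (ihe he.1) (ihf he.2) (· + ·) _
      (fun s => Run.add d d (d + 1) s) hd s hs
  | sub e f ihe ihf =>
    intro d hd s hs
    simpa [cost, eval, compile] using binary_run hκ he.2 (ihe he.1) (ihf he.2) (· - ·) _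
      (fun s => Run.sub d d (d + 1) s) hd s hs
  | load e ihe =>
    intro d hd s hs
    obtain ⟨t₁, s₁, run₁, ht₁, hm₁, hl₁, hv₁⟩ := ihe he d hd s hs
    refine ⟨_, _, run₁.seq (Run.load d d s₁), ?_, hm₁, fun q hq => ?_, ?_⟩
    · simpa [cost] using ht₁
    · simp [State.setReg, hq.ne, hl₁ q hq]
    · simp [State.setReg, eval, hv₁, hm₁]
  | sum r b e ihe =>
    intro d hd s hs
    obtain ⟨hrκ, hr, hbκ, hb, he⟩ := he
    set s₁ := s.setReg d (s.reg b) with hs₁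
    set s₂ := s₁.setReg (d + 1) (s₁.reg r) with hs₂
    set s₃ := s₂.setReg (d + 2) 0 with hs₃
    set s₄ := s₃.setReg r 0 with hs₄
    have hreg : ∀ q, s₄.reg q = if q = r then 0 else if q = d + 2 then 0 else
        if q = d + 1 then s.reg r else if q = d then s.reg b else s.reg q := by
      intro q
      have h1 : r ≠ d := by omega
      simp only [hs₄, hs₃, hs₂, hs₁, State.setReg, Function.update_apply, h1, if_false]
    obtain ⟨t', s', run', ht', hm', hl', hd1', hd2'⟩ := sum_loop_run (N := s.reg b) (ρ := s.reg)
      (C := e.cost.eval B) hd hr hrκ hs he (ihe he (d + 3) (by omega)) (s.reg b) 0 s₄ (by simp)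
      (by rw [hreg]; simp; omega) (by rw [hreg]; simp) (fun q hq hqr => by
        rw [hreg, if_neg hqr, if_neg (by omega), if_neg (by omega), if_neg (by omega)])
    refine ⟨_, _, (Run.copy _ _ _).seq <| (Run.copy _ _ _).seq <| (Run.const _ _ _).seq <|
      (Run.const _ _ _).seq <| run'.seq <| (Run.copy _ _ _).seq (Run.copy _ _ _), ?_, hm',
      fun q hq => ?_, ?_⟩
    · have := Nat.mul_le_mul_right (e.cost.eval B + 5) (hs b hbκ)
      simp only [cost, Polynomial.eval_add, Polynomial.eval_mul, Polynomial.eval_X,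
        Polynomial.eval_ofNat]
      omega
    · by_cases hqr : q = r
      · subst hqr
        simp only [State.setReg, Function.update_apply, hd1', hreg]
        simp [hq.ne, show d + 1 ≠ q by omega]
      · simp [State.setReg, hq.ne, hqr, hl' q hq hqr]
    · have h1 : d + 2 ≠ r := by omega
      have h2 : s₄.mem = s.mem := rfl
      simp only [State.setReg, Function.update_self, Function.update_of_ne h1, hd2', hreg, h1,
        h2, eval, if_false, if_true, zero_add, Finset.range_eq_Ico]

/-! ### Compilation of programs with bounded loops -/

/-- Imperative programs whose loops `forTo r b c` (`R[r] = 0, …, R[b] - 1`) are bounded. -/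
inductive Cmd where
  | assign (r : ℕ) (e : Tm)
  | store (a e : Tm)
  | seq (c c' : Cmd)
  | ite (e : Tm) (c : Cmd)
  | forTo (r b : ℕ) (c : Cmd)

namespace Cmd

/-- The effect of a program. -/
def exec : Cmd → State → State
  | assign r e, s => s.setReg r (e.eval s.reg s.mem)
  | store a e, s => s.setMem (a.eval s.reg s.mem) (e.eval s.reg s.mem)
  | seq c c', s => c'.exec (c.exec s)
  | ite e c, s => if e.eval s.reg s.mem ≠ 0 then c.exec s else s
  | .forTo r b c, s => Nat.rec s (fun i s' => c.exec (s'.setReg r i)) (s.reg b)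

/-- All registers of the program are below `D`, the bounds of loops and sums are below `κ`, and
the registers that are changed are not. -/
def WF (κ D : ℕ) : Cmd → Prop
  | assign r e => κ ≤ r ∧ r < D ∧ e.WF κ D
  | store a e => a.WF κ D ∧ e.WF κ D
  | seq c c' => c.WF κ D ∧ c'.WF κ D
  | ite e c => e.WF κ D ∧ c.WF κ D
  | .forTo r b c => κ ≤ r ∧ r < D ∧ b < κ ∧ c.WF κ D

instance decidableWF (κ D : ℕ) : (c : Cmd) → Decidable (c.WF κ D)
  | assign r e => inferInstanceAs (Decidable (κ ≤ r ∧ r < D ∧ e.WF κ D))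
  | store a e => inferInstanceAs (Decidable (a.WF κ D ∧ e.WF κ D))
  | seq c c' => @instDecidableAnd _ _ (decidableWF κ D c) (decidableWF κ D c')
  | ite _ c => @instDecidableAnd _ _ _ (decidableWF κ D c)
  | .forTo r b c =>
    have := decidableWF κ D c
    inferInstanceAs (Decidable (κ ≤ r ∧ r < D ∧ b < κ ∧ c.WF κ D))

/-- The machine program, with scratch space from register `d` on. -/
def compile : Cmd → ℕ → Prog
  | assign r e, d => .seq (e.compile d) (.copy r d)
  | store a e, d => .seq (a.compile d) (.seq (e.compile (d + 1)) (.store d (d + 1)))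
  | seq c c', d => .seq (c.compile d) (c'.compile d)
  | ite e c, d => .seq (e.compile d) (.ite d (c.compile d) .skip)
  | .forTo r b c, d =>
    .seq (.copy d b) <| .seq (.const (d + 1) 0) <| .loop d <|
      .seq (.copy r (d + 1)) <| .seq (c.compile (d + 2)) <| .seq (.const (d + 2) 1) <|
      .seq (.add (d + 1) (d + 1) (d + 2)) (.sub d d (d + 2))

/-- A polynomial bound for the running time, in a bound for the ranges of loops and sums. -/
noncomputable def cost : Cmd → Polynomial ℕ
  | assign _ e => e.cost + 1
  | store a e => a.cost + e.cost + 1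
  | seq c c' => c.cost + c'.cost
  | ite e c => e.cost + c.cost + 2
  | .forTo _ _ c => Polynomial.X * (c.cost + 5) + 3

/-- The registers below `κ` are never written, so a bound `B` on them at the start bounds every loop
and every sum throughout the execution. This makes the syntactic cost a valid time bound. -/
theorem exec_reg_of_lt {κ D : ℕ} (c : Cmd) (hc : c.WF κ D) (s : State) :
    ∀ q < κ, (c.exec s).reg q = s.reg q := by
  induction c generalizing s with
  | assign r e => intro q hq; simp [exec, State.setReg, show q ≠ r by have := hc.1; omega]
  | store a e => intro q _; rfl
  | seq c c' ih ih' => intro q hq; rw [exec, ih' hc.2 _ q hq, ih hc.1 _ q hq]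
  | ite e c ih =>
    intro q hq
    simp only [exec]
    split
    · exact ih hc.2 s q hq
    · rfl
  | forTo r b c ih =>
    intro q hq
    simp only [exec]
    induction s.reg b with
    | zero => rfl
    | succ k ihk =>
      have hqr : q ≠ r := by have := hc.1; omega
      rw [← ihk]
      exact (ih hc.2.2.2 _ q hq).trans (Function.update_of_ne hqr _ _)

/-- Started in a state that agrees with `σ` up to scratch registers and whose first `κ` registers
are at most `B`, the compiled program has the effect of `c`, within its cost. -/
def Computes (κ D B : ℕ) (c : Cmd) : Prop :=
  ∀ d, D ≤ d → ∀ s σ : State, s.mem = σ.mem → (∀ q < D, s.reg q = σ.reg q) →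
    (∀ q < κ, σ.reg q ≤ B) → ∃ t s', Run (c.compile d) s t s' ∧ t ≤ c.cost.eval B ∧
      s'.mem = (c.exec σ).mem ∧ (∀ q < D, s'.reg q = (c.exec σ).reg q) ∧
      ∀ q < d, D ≤ q → s'.reg q = s.reg q

/-- The machine state is compared with the state after `i` rounds of the loop semantics. The
counters live in `d` and `d + 1`, outside the program registers and below the scratch space of the
body, so the last conclusion of `Computes` for the body shows that they survive it; `r` is refreshed
from `d + 1` in every round. -/
theorem for_loop_run {κ D B d r N : ℕ} {c : Cmd} (hD : D ≤ d) (hrκ : κ ≤ r)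
    (hr : r < D) (hc : c.WF κ D) (ih : c.Computes κ D B) (σ : State) (k : ℕ) :
    ∀ (i : ℕ) (s : State), i + k = N → s.reg d = k → s.reg (d + 1) = i →
      s.mem = (Nat.rec σ (fun i s' => c.exec (s'.setReg r i)) i : State).mem →
      (∀ q < D, s.reg q = (Nat.rec σ (fun i s' => c.exec (s'.setReg r i)) i : State).reg q) →
      (∀ q < κ, (Nat.rec σ (fun i s' => c.exec (s'.setReg r i)) i : State).reg q ≤ B) →
      ∃ t s', Run (.loop d <|
      .seq (.copy r (d + 1)) <| .seq (c.compile (d + 2)) <| .seq (.const (d + 2) 1) <|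
      .seq (.add (d + 1) (d + 1) (d + 2)) (.sub d d (d + 2))) s t s' ∧
      t ≤ k * (c.cost.eval B + 5) + 1 ∧
      s'.mem = (Nat.rec σ (fun i s' => c.exec (s'.setReg r i)) N : State).mem ∧
      (∀ q < D, s'.reg q = (Nat.rec σ (fun i s' => c.exec (s'.setReg r i)) N : State).reg q) ∧
      ∀ q < d, D ≤ q → s'.reg q = s.reg q := by
  induction k with
  | zero =>
    intro i s hi hk _ hm hq _
    obtain rfl : i = N := by omega
    exact ⟨1, s, Run.loop_exit _ hk, by simp, hm, hq, fun _ _ _ => rfl⟩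
  | succ k ihk =>
    intro i s hi hk hki hm hq hB
    set τ : State := Nat.rec σ (fun i s' => c.exec (s'.setReg r i)) i with hτ
    have hτ' : (Nat.rec σ (fun i s' => c.exec (s'.setReg r i)) (i + 1) : State) =
      c.exec (τ.setReg r i) := rfl
    have hB' : ∀ q < κ, (τ.setReg r i).reg q ≤ B := fun q hq => by
      simpa [State.setReg, show q ≠ r by omega] using hB q hq
    obtain ⟨t₁, s₁, run₁, ht₁, hm₁, hl₁, hf₁⟩ := ih (d + 2) (by omega) (s.setReg r i)
      (τ.setReg r i) hm (fun q hqD => by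
        by_cases hqr : q = r
        · simp [State.setReg, hqr]
        · simp [State.setReg, hqr, hq q hqD]) hB'
    set s₂ := s₁.setReg (d + 2) 1 with hs₂
    set s₃ := s₂.setReg (d + 1) (s₂.reg (d + 1) + s₂.reg (d + 2)) with hs₃
    set s₄ := s₃.setReg d (s₃.reg d - s₃.reg (d + 2)) with hs₄
    have hreg : ∀ q, s₄.reg q = if q = d then k else if q = d + 1 then i + 1 else
        if q = d + 2 then 1 else s₁.reg q := by
      intro q
      have h1 := hf₁ d (by omega) hD
      have h2 := hf₁ (d + 1) (by omega) (by omega)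
      simp only [State.setReg, Function.update_of_ne (show d ≠ r by omega),
        Function.update_of_ne (show d + 1 ≠ r by omega), hk, hki] at h1 h2
      simp only [hs₄, hs₃, hs₂, State.setReg, Function.update_apply, h1, h2]
      simp
    obtain ⟨t', s', run', ht', hm', hl', hf'⟩ := ihk (i + 1) s₄ (by omega)
      (by rw [hreg]; simp) (by rw [hreg]; simp) hm₁
      (fun q hqD => by
        rw [hreg, if_neg (by omega), if_neg (by omega), if_neg (by omega), hl₁ q hqD, hτ'])
      (fun q hqκ => by rw [hτ', exec_reg_of_lt c hc _ q hqκ]; exact hB' q hqκ)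
    have hcopy : Run (.copy r (d + 1)) s 1 (s.setReg r i) := by
      have := Run.copy r (d + 1) s
      rwa [hki] at this
    refine ⟨_, s', Run.loop_step (by omega) (hcopy.seq <| run₁.seq <|
      (Run.const _ _ _).seq <| (Run.add _ _ _ _).seq (Run.sub _ _ _ _)) run', ?_,
      hm', hl', fun q hqd hDq => ?_⟩
    · nlinarith
    · rw [hf' q hqd hDq, hreg, if_neg (by omega), if_neg (by omega), if_neg (by omega),
        hf₁ q (by omega) hDq]
      simp [State.setReg, show q ≠ r by omega]

theorem compile_run {κ D B : ℕ} (hκ : κ ≤ D) (c : Cmd) (hc : c.WF κ D) : c.Computes κ D B := by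
  induction c with
  | assign r e =>
    intro d hd s σ hm hq hB
    obtain ⟨hrκ, hrD, he⟩ := hc
    obtain ⟨t₁, s₁, run₁, ht₁, hm₁, hl₁, hv₁⟩ := e.compile_run hκ he d hd s (fun q hqκ => by
      rw [hq q (by omega)]; exact hB q hqκ)
    refine ⟨_, _, run₁.seq (Run.copy r d s₁), ?_, hm₁.trans hm, fun q hqD => ?_,
      fun q hqd hDq => ?_⟩
    · simpa [cost] using ht₁
    · by_cases hqr : q = r
      · simp [State.setReg, hqr, hv₁, exec, hm, e.eval_congr he hq]
      · simp [State.setReg, hqr, exec, hl₁ q (by omega), hq q hqD]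
    · simp [State.setReg, show q ≠ r by omega, hl₁ q hqd]
  | store a e =>
    intro d hd s σ hm hq hB
    obtain ⟨ha, he⟩ := hc
    obtain ⟨t₁, s₁, run₁, ht₁, hm₁, hl₁, hv₁⟩ := a.compile_run hκ ha d hd s (fun q hqκ => by
      rw [hq q (by omega)]; exact hB q hqκ)
    obtain ⟨t₂, s₂, run₂, ht₂, hm₂, hl₂, hv₂⟩ := e.compile_run hκ he (d + 1) (by omega) s₁
      (fun q hqκ => by rw [hl₁ q (by omega), hq q (by omega)]; exact hB q hqκ)
    refine ⟨_, _, run₁.seq (run₂.seq (Run.store d (d + 1) s₂)), ?_, ?_, fun q hqD => ?_,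
      fun q hqd hDq => ?_⟩
    · simp only [cost, Polynomial.eval_add, Polynomial.eval_one]; omega
    · simp only [State.setMem, exec, hl₂ d (by omega), hv₁, hv₂, hm₁, hm₂, hm,
        a.eval_congr ha hq, e.eval_congr he (fun q hq' => (hl₁ q (by omega)).trans (hq q hq'))]
    · simp [State.setMem, exec, hl₂ q (by omega), hl₁ q (by omega), hq q hqD]
    · simp [State.setMem, hl₂ q (by omega), hl₁ q hqd]
  | seq c c' ih ih' =>
    intro d hd s σ hm hq hB
    obtain ⟨t₁, s₁, run₁, ht₁, hm₁, hl₁, hf₁⟩ := ih hc.1 d hd s σ hm hq hB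
    obtain ⟨t₂, s₂, run₂, ht₂, hm₂, hl₂, hf₂⟩ := ih' hc.2 d hd s₁ _ hm₁ hl₁ (fun q hqκ => by
      rw [exec_reg_of_lt c hc.1 _ q hqκ]; exact hB q hqκ)
    refine ⟨_, _, run₁.seq run₂, ?_, hm₂, hl₂, fun q hqd hDq => ?_⟩
    · simp only [cost, Polynomial.eval_add]; omega
    · rw [hf₂ q hqd hDq, hf₁ q hqd hDq]
  | ite e c ih =>
    intro d hd s σ hm hq hB
    obtain ⟨he, hc⟩ := hc
    obtain ⟨t₁, s₁, run₁, ht₁, hm₁, hl₁, hv₁⟩ := e.compile_run hκ he d hd s (fun q hqκ => by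
      rw [hq q (by omega)]; exact hB q hqκ)
    rw [hm, e.eval_congr he hq] at hv₁
    simp only [exec, cost, Polynomial.eval_add, Polynomial.eval_ofNat]
    by_cases h : e.eval σ.reg σ.mem = 0
    · refine ⟨_, _, run₁.seq (Run.ite_false _ (hv₁.trans h) (Run.skip s₁)), by omega, ?_⟩
      simp only [h, ne_eq, not_true_eq_false, if_false]
      exact ⟨hm₁.trans hm, fun q hqD => (hl₁ q (by omega)).trans (hq q hqD),
        fun q hqd _ => hl₁ q hqd⟩
    · obtain ⟨t₂, s₂, run₂, ht₂, hm₂, hl₂, hf₂⟩ := ih hc d hd s₁ σ (hm₁.trans hm)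
        (fun q hqD => (hl₁ q (by omega)).trans (hq q hqD)) hB
      refine ⟨_, _, run₁.seq (Run.ite_true _ (by rwa [hv₁]) run₂), by omega, ?_⟩
      simp only [h, ne_eq, not_false_eq_true, if_true]
      exact ⟨hm₂, hl₂, fun q hqd hDq => (hf₂ q hqd hDq).trans (hl₁ q hqd)⟩
  | forTo r b c ih =>
    intro d hd s σ hm hq hB
    obtain ⟨hrκ, hr, hb, hc⟩ := hc
    set s₁ := s.setReg d (s.reg b) with hs₁
    set s₂ := s₁.setReg (d + 1) 0 with hs₂
    have hreg : ∀ q < d, s₂.reg q = s.reg q := fun q hqd => by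
      simp [hs₁, hs₂, State.setReg, hqd.ne, show q ≠ d + 1 by omega]
    obtain ⟨t', s', run', ht', hm', hl', hf'⟩ := for_loop_run (N := σ.reg b) hd hrκ hr hc
      (ih hc) σ (σ.reg b) 0 s₂ (by simp) (by simp [hs₁, hs₂, State.setReg, hq b (by omega)])
      (by simp [hs₂, State.setReg]) hm (fun q hqD => (hreg q (by omega)).trans (hq q hqD)) hB
    refine ⟨_, s', (Run.copy _ _ _).seq <| (Run.const _ _ _).seq run', ?_, hm', hl',
      fun q hqd hDq => (hf' q hqd hDq).trans (hreg q hqd)⟩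
    have := Nat.mul_le_mul_right (c.cost.eval B + 5) (hB b hb)
    simp only [cost, Polynomial.eval_add, Polynomial.eval_mul, Polynomial.eval_X,
      Polynomial.eval_ofNat]
    omega

end Cmd

end RAM

/-! ### Snapshot isolation as reachability of the full set of events -/

namespace History

/-- The transaction `t` may take its snapshot: all its predecessors in `so` and `wr` are committed.
A set `S` of events contains `t` if `t` has taken its snapshot, and `n + t` if `t` is committed. -/
def SnapshotEnabled (h : History) (S : Finset ℕ) (t : Fin h.n) : Prop :=
  (t : ℕ) ∉ S ∧ ∀ a, (h.so a t ∨ h.wrTx a t) → h.n + a ∈ S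

/-- The transaction `t` may commit: it has taken its snapshot, no transaction will read a value
that `t` overwrites, and no active transaction is in conflict with `t`. -/
def CommitEnabled (h : History) (S : Finset ℕ) (t : Fin h.n) : Prop :=
  h.n + t ∉ S ∧ (t : ℕ) ∈ S ∧ ∀ x, (h.tx t).Writes x →
    (∀ t₁ t₃, h.wrVar x t₁ t₃ → h.n + t₁ ∈ S → (t₃ : ℕ) ∈ S) ∧
    ∀ t₄, t₄ ≠ t → (h.tx t₄).Writes x → (t₄ : ℕ) ∈ S → h.n + t₄ ∈ S

/-- The event `e` may happen after the events in `S`. -/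
def Enabled (h : History) (S : Finset ℕ) (e : ℕ) : Prop :=
  ∃ t : Fin h.n, (e = t ∧ h.SnapshotEnabled S t) ∨ (e = h.n + t ∧ h.CommitEnabled S t)

/-- One more event happens. -/
def Step (h : History) (S S' : Finset ℕ) : Prop :=
  ∃ e, h.Enabled S e ∧ S' = insert e S

/-- The sets of events that may happen first. -/
def Reachable (h : History) (S : Finset ℕ) : Prop :=
  Relation.ReflTransGen h.Step ∅ S

/-- `f` and `g` are the times of the commits and of the snapshots of an execution of the events in
`S` before the time `τ`. -/
structure Schedule (h : History) (S : Finset ℕ) (f g : Fin h.n → ℕ) (τ : ℕ) : Prop where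
  commit_lt : ∀ t : Fin h.n, h.n + t ∈ S → f t < τ
  snapshot_lt : ∀ t : Fin h.n, (t : ℕ) ∈ S → g t < τ
  commit_inj : ∀ t t' : Fin h.n, h.n + t ∈ S → h.n + t' ∈ S → f t = f t' → t = t'
  snapshot_mem : ∀ t : Fin h.n, h.n + t ∈ S → (t : ℕ) ∈ S
  snapshot_lt_commit : ∀ t : Fin h.n, h.n + t ∈ S → g t < f t
  pred : ∀ a t : Fin h.n, (h.so a t ∨ h.wrTx a t) → (t : ℕ) ∈ S → h.n + a ∈ S ∧ f a < g t
  overwrite : ∀ x t₁ t₂ t₃, h.wrVar x t₁ t₃ → (h.tx t₂).Writes x → h.n + t₁ ∈ S → h.n + t₂ ∈ S →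
    f t₁ < f t₂ → (t₃ : ℕ) ∈ S ∧ g t₃ < f t₂
  conflict : ∀ x t₃ t₄, t₄ ≠ t₃ → (h.tx t₃).Writes x → (h.tx t₄).Writes x → (t₃ : ℕ) ∈ S →
    h.n + t₄ ∈ S → f t₄ < g t₃ ∨ h.n + t₃ ∈ S ∧ f t₃ < f t₄

variable {h : History} {S S' : Finset ℕ}

/-- Each event gets the time of the step at which it happens: a new event gets time `τ`, later than
all others. A new snapshot comes after every commit so far, and the two clauses of `CommitEnabled`
on written variables give `overwrite` and `conflict` for a new commit. -/
theorem Reachable.exists_schedule (hS : h.Reachable S) : ∃ f g τ, h.Schedule S f g τ := by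
  induction hS with
  | refl => exact ⟨0, 0, 0, by constructor <;> simp⟩
  | @tail S S' _ hstep ih =>
    obtain ⟨f, g, τ, ih⟩ := ih
    obtain ⟨e, ⟨t, ⟨rfl, h1, h2⟩ | ⟨rfl, h1, h2, h3⟩⟩, rfl⟩ := hstep
    · have hne : ∀ a : Fin h.n, h.n + (a : ℕ) ≠ t := fun a => by omega
      refine ⟨f, Function.update g t τ, τ + 1, ?_⟩
      have hmem : ∀ a : Fin h.n, (a : ℕ) ∈ insert (t : ℕ) S ↔ a = t ∨ (a : ℕ) ∈ S := by
        simp [Fin.ext_iff]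
      have hmem' : ∀ a : Fin h.n, h.n + (a : ℕ) ∈ insert (t : ℕ) S ↔ h.n + (a : ℕ) ∈ S := by
        simp [hne]
      have key : ∀ a : Fin h.n, (a : ℕ) ∈ S → Function.update g t τ a = g a := fun a ha =>
        Function.update_of_ne (by rintro rfl; exact h1 ha) _ _
      constructor
      · intro a ha
        have := ih.commit_lt a ((hmem' a).1 ha)
        omega
      · intro a ha
        rcases (hmem a).1 ha with rfl | ha
        · simp
        · rw [key a ha]; have := ih.snapshot_lt a ha; omega
      · intro a b ha hb
        exact ih.commit_inj a b ((hmem' a).1 ha) ((hmem' b).1 hb)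
      · intro a ha
        exact (hmem a).2 (.inr (ih.snapshot_mem a ((hmem' a).1 ha)))
      · intro a ha
        rw [hmem'] at ha
        rw [key a (ih.snapshot_mem a ha)]
        exact ih.snapshot_lt_commit a ha
      · intro a b hab hb
        rw [hmem']
        rcases (hmem b).1 hb with rfl | hb
        · simpa using ⟨h2 a hab, ih.commit_lt a (h2 a hab)⟩
        · rw [key b hb]; exact ih.pred a b hab hb
      · intro x t₁ t₂ t₃ hw hx ht₁ ht₂ hlt
        rw [hmem'] at ht₁ ht₂
        obtain ⟨h4, h5⟩ := ih.overwrite x t₁ t₂ t₃ hw hx ht₁ ht₂ hlt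
        rw [key t₃ h4]
        exact ⟨(hmem t₃).2 (.inr h4), h5⟩
      · intro x t₃ t₄ hn hx hx' ht₃ ht₄
        rw [hmem'] at ht₄ ⊢
        rcases (hmem t₃).1 ht₃ with rfl | ht₃
        · exact .inl (by simpa using ih.commit_lt _ ht₄)
        · rw [key t₃ ht₃]
          exact ih.conflict x t₃ t₄ hn hx hx' ht₃ ht₄
    · have hne : ∀ a : Fin h.n, (a : ℕ) ≠ h.n + t := fun a => by omega
      refine ⟨Function.update f t τ, g, τ + 1, ?_⟩
      have hmem : ∀ a : Fin h.n, h.n + (a : ℕ) ∈ insert (h.n + (t : ℕ)) S ↔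
          a = t ∨ h.n + (a : ℕ) ∈ S := by simp [Fin.ext_iff]
      have hmem' : ∀ a : Fin h.n, (a : ℕ) ∈ insert (h.n + (t : ℕ)) S ↔ (a : ℕ) ∈ S := by
        simp [hne]
      have key : ∀ a : Fin h.n, h.n + (a : ℕ) ∈ S → Function.update f t τ a = f a := fun a ha =>
        Function.update_of_ne (by rintro rfl; exact h1 ha) _ _
      constructor
      · intro a ha
        rcases (hmem a).1 ha with rfl | ha
        · simp
        · rw [key a ha]; have := ih.commit_lt a ha; omega
      · intro a ha
        have := ih.snapshot_lt a ((hmem' a).1 ha)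
        omega
      · intro a b ha hb hab
        rcases (hmem a).1 ha with rfl | ha' <;> rcases (hmem b).1 hb with rfl | hb'
        · rfl
        · rw [key b hb', Function.update_self] at hab
          have := ih.commit_lt b hb'; omega
        · rw [key a ha', Function.update_self] at hab
          have := ih.commit_lt a ha'; omega
        · rw [key a ha', key b hb'] at hab
          exact ih.commit_inj a b ha' hb' hab
      · intro a ha
        rw [hmem']
        rcases (hmem a).1 ha with rfl | ha
        · exact h2
        · exact ih.snapshot_mem a ha
      · intro a ha
        rcases (hmem a).1 ha with rfl | ha
        · simpa using ih.snapshot_lt _ h2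
        · rw [key a ha]; exact ih.snapshot_lt_commit a ha
      · intro a b hab hb
        obtain ⟨h4, h5⟩ := ih.pred a b hab ((hmem' b).1 hb)
        rw [key a h4]
        exact ⟨(hmem a).2 (.inr h4), h5⟩
      · intro x t₁ t₂ t₃ hw hx ht₁ ht₂ hlt
        rw [hmem']
        rcases (hmem t₂).1 ht₂ with rfl | ht₂' <;> rcases (hmem t₁).1 ht₁ with rfl | ht₁'
        · exact absurd hlt (lt_irrefl _)
        · have := (h3 x hx).1 t₁ t₃ hw ht₁'
          simpa using ⟨this, ih.snapshot_lt _ this⟩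
        · rw [key t₂ ht₂', Function.update_self] at hlt
          have := ih.commit_lt t₂ ht₂'; omega
        · rw [key t₁ ht₁', key t₂ ht₂'] at hlt
          rw [key t₂ ht₂']
          exact ih.overwrite x t₁ t₂ t₃ hw hx ht₁' ht₂' hlt
      · intro x t₃ t₄ hn hx hx' ht₃ ht₄
        rw [hmem'] at ht₃
        rw [hmem]
        rcases (hmem t₄).1 ht₄ with rfl | ht₄
        · have := (h3 x hx').2 t₃ (Ne.symm hn) hx ht₃
          rw [key t₃ this, Function.update_self]
          exact .inr ⟨.inr this, ih.commit_lt _ this⟩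
        · rw [key t₄ ht₄]
          rcases ih.conflict x t₃ t₄ hn hx hx' ht₃ ht₄ with h4 | ⟨h4, h5⟩
          · exact .inl h4
          · rw [key t₃ h4]
            exact .inr ⟨.inr h4, h5⟩

theorem snapshotIsolation_of_reachable (hS : h.Reachable S) (hfull : ∀ e < 2 * h.n, e ∈ S) :
    h.SnapshotIsolation := by
  obtain ⟨f, g, τ, H⟩ := hS.exists_schedule
  have hA : ∀ t : Fin h.n, (t : ℕ) ∈ S := fun t => hfull _ (by omega)
  have hC : ∀ t : Fin h.n, h.n + (t : ℕ) ∈ S := fun t => hfull _ (by omega)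
  have hle : ∀ t t' : Fin h.n, Relation.ReflTransGen (fun a b => f a < f b) t t' → f t ≤ f t' := by
    intro t t' htt'
    induction htt' with
    | refl => exact le_rfl
    | tail _ hlt ih => exact ih.trans hlt.le
  -- A version of `x` committed before the snapshot of `t₃` cannot be newer than the version that
  -- `t₃` reads: by `overwrite`, a newer one is committed only after that snapshot. Both axioms
  -- reduce to this.
  have key : ∀ x t₁ t₂ t₃, t₁ ≠ t₂ → h.wrVar x t₁ t₃ → (h.tx t₂).Writes x → f t₂ < g t₃ →
      f t₂ < f t₁ := by
    intro x t₁ t₂ t₃ hne hw hx hlt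
    by_contra hcon
    have h1 : f t₁ ≠ f t₂ := fun heq => hne (H.commit_inj _ _ (hC _) (hC _) heq)
    have := (H.overwrite x t₁ t₂ t₃ hw hx (hC _) (hC _) (by omega)).2
    omega
  refine ⟨fun a b => f a < f b, ?_, fun a b hab => ?_, ?_, ?_⟩
  · have : Std.Trichotomous fun a b : Fin h.n => f a < f b := ⟨fun a b h1 h2 =>
      H.commit_inj _ _ (hC _) (hC _) (by omega)⟩
    have : Std.Irrefl fun a b : Fin h.n => f a < f b := ⟨fun a => lt_irrefl _⟩
    have : IsTrans (Fin h.n) fun a b => f a < f b := ⟨fun a b c => lt_trans⟩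
    exact { }
  · exact (H.pred a b hab.symm (hA b)).2.trans (H.snapshot_lt_commit b (hC b))
  · rintro x t₁ t₂ t₃ hne hw hx ⟨t₄, h24, h43⟩
    exact key x t₁ t₂ t₃ hne hw hx ((hle _ _ h24).trans_lt (H.pred t₄ t₃ h43.symm (hA t₃)).2)
  · intro x t₁ t₂ t₃ t₄ y hne hw hx hy hy' h24 h43
    have h1 : t₄ ≠ t₃ := by rintro rfl; exact lt_irrefl _ h43
    refine key x t₁ t₂ t₃ hne hw hx ((hle _ _ h24).trans_lt ?_)
    -- Of two transactions with a common written variable, the one that commits first does so before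
    -- the other takes its snapshot.
    rcases H.conflict y t₃ t₄ h1 hy hy' (hA t₃) (hC t₄) with h2 | ⟨-, h2⟩
    · exact h2
    · omega

/-- A snapshot waits only for commits, so snapshots that are possible now remain possible after
other snapshots and can be taken in any order. -/
theorem Reachable.snapshot_insert (X : Finset (Fin h.n)) (hS : h.Reachable S)
    (hX : ∀ t ∈ X, ∀ a, (h.so a t ∨ h.wrTx a t) → h.n + a ∈ S) :
    h.Reachable (S ∪ X.image (fun t : Fin h.n => (t : ℕ))) := by
  induction X using Finset.induction_on with
  | empty => simpa using hS
  | insert t X _ ih =>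
    have ih := ih fun t' ht' => hX t' (Finset.mem_insert_of_mem ht')
    rw [Finset.image_insert, Finset.union_insert]
    by_cases ht : (t : ℕ) ∈ S ∪ X.image (fun t : Fin h.n => (t : ℕ))
    · rwa [Finset.insert_eq_of_mem ht]
    · exact ih.tail ⟨t, ⟨t, .inl ⟨rfl, ht, fun a ha =>
        Finset.mem_union_left _ (hX t (Finset.mem_insert_self _ _) a ha)⟩⟩, rfl⟩

/-- The transactions that have to be committed before the snapshot of `t` is taken, if
transactions are committed in the order `co`. -/
def Before (h : History) (co : Fin h.n → Fin h.n → Prop) (t a : Fin h.n) : Prop :=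
  ∃ b, Relation.ReflTransGen co a b ∧ ((h.so b t ∨ h.wrTx b t) ∨
    co b t ∧ ∃ y, (h.tx t).Writes y ∧ (h.tx b).Writes y)

theorem exists_reachable_of_snapshotIsolation (hSI : h.SnapshotIsolation) :
    ∃ S, h.Reachable S ∧ ∀ e < 2 * h.n, e ∈ S := by
  classical
  obtain ⟨co, hco, hext, hprefix, hconflict⟩ := hSI
  have htrans : ∀ a b c, co a b → co b c → co a c := fun a b c => hco.trans a b c
  have hirr : ∀ a, ¬ co a a := fun a => hco.irrefl a
  have htri : ∀ a b, a ≠ b → co a b ∨ co b a := fun a b hab => by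
    by_contra hcon
    push Not at hcon
    exact hab (hco.toTrichotomous.trichotomous a b hcon.1 hcon.2)
  -- The rank in `co`: the number of transactions to be committed earlier.
  set p : Fin h.n → ℕ := fun t => (Finset.univ.filter fun a => co a t).card with hp
  have hlt : ∀ a b, co a b → p a < p b := fun a b hab => by
    refine Finset.card_lt_card ⟨fun c hc => ?_, fun hcon => ?_⟩
    · simp only [Finset.mem_filter, Finset.mem_univ, true_and] at hc ⊢
      exact htrans _ _ _ hc hab
    · exact hirr a (by simpa using hcon (show a ∈ _ by simpa using hab))
  have hlt' : ∀ a b, p a < p b → co a b := fun a b hab => by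
    rcases htri a b (by rintro rfl; exact lt_irrefl _ hab) with h1 | h1
    · exact h1
    · have := hlt _ _ h1; omega
  have hpn : ∀ a, p a < h.n := fun a => by
    have : (Finset.univ.filter fun b => co b a).card < (Finset.univ : Finset (Fin h.n)).card :=
      Finset.card_lt_card ⟨Finset.subset_univ _, fun hcon => hirr a (by
        simpa using hcon (Finset.mem_univ a))⟩
    simpa [hp] using this
  have hpinj : Function.Injective p := fun a b hab => by
    by_contra hne
    rcases htri a b hne with h1 | h1 <;> have := hlt _ _ h1 <;> omega
  have hle : ∀ a b, Relation.ReflTransGen co a b → p a ≤ p b := by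
    intro a b hab
    induction hab with
    | refl => exact le_rfl
    | tail _ h1 ih => exact ih.trans (hlt _ _ h1).le
  have hbefore : ∀ t a, h.Before co t a → p a < p t := by
    rintro t a ⟨b, hab, h1 | ⟨h1, -⟩⟩
    · exact (hle _ _ hab).trans_lt (hlt _ _ (hext b t h1.symm))
    · exact (hle _ _ hab).trans_lt (hlt _ _ h1)
  -- The only use of Prefix and Conflict; they correspond to the two alternatives in `Before`.
  have hco_of_before : ∀ x t₁ t₂ t₃, t₁ ≠ t₂ → h.wrVar x t₁ t₃ → (h.tx t₂).Writes x →
      h.Before co t₃ t₂ → co t₂ t₁ := by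
    rintro x t₁ t₂ t₃ hne hw hx ⟨b, hb, h1 | ⟨h1, y, hy, hy'⟩⟩
    · exact hprefix x t₁ t₂ t₃ hne hw hx ⟨b, hb, h1.symm⟩
    · exact hconflict x t₁ t₂ t₃ b y hne hw hx hy hy' hb h1
  -- Stage `m`: exactly the first `m` transactions in `co` are committed, and exactly those
  -- snapshots are taken whose required commits are among them.
  have hstage : ∀ m ≤ h.n, ∃ S, h.Reachable S ∧ (∀ t : Fin h.n, h.n + t ∈ S ↔ p t < m) ∧
      ∀ t : Fin h.n, (t : ℕ) ∈ S ↔ ∀ a, h.Before co t a → p a < m := by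
    have himage : ∀ (S : Finset ℕ) (X : Finset (Fin h.n)) (t : Fin h.n),
        ((t : ℕ) ∈ S ∪ X.image (fun t : Fin h.n => (t : ℕ)) ↔ (t : ℕ) ∈ S ∨ t ∈ X) ∧
        (h.n + (t : ℕ) ∈ S ∪ X.image (fun t : Fin h.n => (t : ℕ)) ↔ h.n + (t : ℕ) ∈ S) := by
      intro S X t
      simp only [Finset.mem_union, Finset.mem_image]
      refine ⟨or_congr_right ⟨?_, fun ht => ⟨t, ht, rfl⟩⟩, or_iff_left ?_⟩
      · rintro ⟨a, ha, hat⟩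
        rwa [show t = a from Fin.ext hat.symm]
      · rintro ⟨a, -, hat⟩
        omega
    have hpre : ∀ a t, (h.so a t ∨ h.wrTx a t) → h.Before co t a := fun a t hat =>
      ⟨a, .refl, .inl hat⟩
    intro m
    induction m with
    | zero =>
      intro _
      refine ⟨_, Reachable.snapshot_insert (Finset.univ.filter fun t => ∀ a, ¬ h.Before co t a)
        .refl fun t ht a hat => ?_, fun t => ?_, fun t => ?_⟩
      · simp only [Finset.mem_filter, Finset.mem_univ, true_and] at ht
        exact absurd (hpre a t hat) (ht a)
      · rw [(himage _ _ t).2]; simp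
      · rw [(himage _ _ t).1]; simp
    | succ m ih =>
      intro hm
      obtain ⟨S, hS, hC, hA⟩ := ih (by omega)
      obtain ⟨c, hc⟩ : ∃ c, p c = m := by
        have hinj : Function.Injective fun a => (⟨p a, hpn a⟩ : Fin h.n) := fun a b hab =>
          hpinj (by simpa using hab)
        obtain ⟨c, hc⟩ := (Finite.injective_iff_surjective.1 hinj) ⟨m, hm⟩
        exact ⟨c, by simpa using hc⟩
      have hcommit : h.CommitEnabled S c := by
        refine ⟨by rw [hC]; omega, (hA c).2 fun a ha => hc ▸ hbefore c a ha, fun x hx =>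
          ⟨fun t₁ t₃ hw ht₁ => ?_, fun t₄ hne hx' ht₄ => ?_⟩⟩
        -- If a reader `t₃` of the committed `t₁` has no snapshot yet, some required commit `a` is
        -- missing. The next transaction `c` is `a` or precedes it in `co`, so `c` is required as
        -- well, and the axioms put `c` before `t₁`, which has smaller rank: a contradiction.
        · rw [hC] at ht₁
          by_contra hcon
          rw [hA] at hcon
          push Not at hcon
          obtain ⟨a, ⟨b, hab, hb⟩, hma⟩ := hcon
          have hca : Relation.ReflTransGen co c a := by
            rcases eq_or_ne c a with rfl | hca
            · exact .refl
            · exact .single (hlt' _ _ (by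
                have := hpinj.ne hca
                omega))
          have := hlt _ _ (hco_of_before x t₁ c t₃ (by rintro rfl; omega) hw hx ⟨b, hca.trans hab, hb⟩)
          omega
        · rw [hC]
          by_contra hcon
          have hco : co c t₄ := hlt' _ _ (by have := hpinj.ne hne; omega)
          have := (hA t₄).1 ht₄ c ⟨c, .refl, .inr ⟨hco, x, hx', hx⟩⟩
          omega
      have hC' : ∀ t : Fin h.n, h.n + (t : ℕ) ∈ insert (h.n + (c : ℕ)) S ↔ p t < m + 1 := by
        intro t
        rw [Finset.mem_insert, hC, Nat.add_left_cancel_iff, Fin.val_inj]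
        refine ⟨?_, fun ht => ?_⟩
        · rintro (rfl | ht) <;> omega
        · rcases eq_or_ne t c with rfl | hne
          · exact .inl rfl
          · have := hpinj.ne hne
            right; omega
      refine ⟨_, Reachable.snapshot_insert
        (Finset.univ.filter fun t => ∀ a, h.Before co t a → p a < m + 1)
        (hS.tail ⟨_, ⟨c, .inr ⟨rfl, hcommit⟩⟩, rfl⟩) fun t ht a hat => ?_, fun t => ?_, fun t => ?_⟩
      · simp only [Finset.mem_filter, Finset.mem_univ, true_and] at ht
        exact (hC' a).2 (ht a (hpre a t hat))
      · rw [(himage _ _ t).2, hC']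
      · rw [(himage _ _ t).1, Finset.mem_insert, hA]
        simp only [Finset.mem_filter, Finset.mem_univ, true_and]
        refine ⟨?_, .inr⟩
        rintro ((ht | ht) | ht)
        · omega
        · exact fun a ha => (ht a ha).trans (by omega)
        · exact ht
  obtain ⟨S, hS, hC, hA⟩ := hstage h.n le_rfl
  refine ⟨S, hS, fun e he => ?_⟩
  rcases lt_or_ge e h.n with he' | he'
  · exact (hA ⟨e, he'⟩).2 fun a _ => hpn a
  · have := (hC ⟨e - h.n, by omega⟩).2 (hpn _)
    rwa [show h.n + (e - h.n) = e by omega] at this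

/-- Snapshot isolation holds if and only if all events can happen. -/
theorem snapshotIsolation_iff :
    h.SnapshotIsolation ↔ ∃ S, h.Reachable S ∧ ∀ e < 2 * h.n, e ∈ S :=
  ⟨exists_reachable_of_snapshotIsolation, fun ⟨_, hS, hfull⟩ =>
    snapshotIsolation_of_reachable hS hfull⟩

/-! ### Counting reachable sets by pairs of antichains -/

theorem Reachable.subset_range (hS : h.Reachable S) : S ⊆ Finset.range (2 * h.n) := by
  induction hS with
  | refl => simp
  | tail _ hstep ih =>
    obtain ⟨e, ⟨t, he⟩, rfl⟩ := hstep
    refine Finset.insert_subset (Finset.mem_range.2 ?_) ih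
    rcases he with ⟨rfl, -⟩ | ⟨rfl, -⟩ <;> omega

open Classical in
/-- The committed transactions without a committed successor in session order. -/
noncomputable def committedMax (h : History) (S : Finset ℕ) : Finset (Fin h.n) :=
  Finset.univ.filter fun t => h.n + (t : ℕ) ∈ S ∧ ∀ a : Fin h.n, h.n + (a : ℕ) ∈ S → ¬ h.so t a

open Classical in
/-- The active transactions. -/
noncomputable def active (h : History) (S : Finset ℕ) : Finset (Fin h.n) :=
  Finset.univ.filter fun t => (t : ℕ) ∈ S ∧ h.n + (t : ℕ) ∉ S

theorem card_le_width {s : Finset (Fin h.n)} (hs : IsAntichain h.so (s : Set (Fin h.n))) :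
    s.card ≤ h.width := by
  classical
  exact Finset.le_sup (f := Finset.card) (by simpa using hs)

theorem card_committedMax_le : (h.committedMax S).card ≤ h.width := by
  refine card_le_width fun a ha b hb _ hab => ?_
  simp only [committedMax, Finset.coe_filter, Finset.mem_univ, true_and, Set.mem_ofPred_eq] at ha hb
  exact ha.2 b hb.1 hab

/-- If `a` precedes an active `b` in session order, then `a` was committed before the snapshot of
`b`, so `a` is no longer active. -/
theorem Reachable.card_active_le (hS : h.Reachable S) : (h.active S).card ≤ h.width := by
  obtain ⟨f, g, τ, H⟩ := hS.exists_schedule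
  refine card_le_width fun a ha b hb _ hab => ?_
  simp only [active, Finset.coe_filter, Finset.mem_univ, true_and, Set.mem_ofPred_eq] at ha hb
  exact ha.2 (H.pred a b (.inl hab) hb.1).1

/-- The committed transactions are closed downwards in `so`, and by finiteness each of them lies
below a maximal one. -/
theorem Reachable.committed_iff (hS : h.Reachable S) (t : Fin h.n) :
    h.n + (t : ℕ) ∈ S ↔ ∃ a ∈ h.committedMax S, t = a ∨ h.so t a := by
  obtain ⟨f, g, τ, H⟩ := hS.exists_schedule
  have hdown : ∀ a b : Fin h.n, h.so a b → h.n + (b : ℕ) ∈ S → h.n + (a : ℕ) ∈ S :=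
    fun a b hab hb => (H.pred a b (.inl hab) (H.snapshot_mem b hb)).1
  constructor
  · have : IsTrans (Fin h.n) (Function.swap h.so) := ⟨fun a b c hab hbc => h.so_trans c b a hbc hab⟩
    have : Std.Irrefl (Function.swap h.so) := ⟨h.so_irrefl⟩
    have hwf : WellFounded (Function.swap h.so) := Finite.wellFounded_of_trans_of_irrefl _
    induction t using hwf.induction with
    | _ t ih =>
      intro ht
      by_cases hmax : ∀ a : Fin h.n, h.n + (a : ℕ) ∈ S → ¬ h.so t a
      · exact ⟨t, by simp [committedMax, ht]; exact hmax, .inl rfl⟩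
      · push Not at hmax
        obtain ⟨a, ha, hta⟩ := hmax
        obtain ⟨b, hb, hab⟩ := ih a hta ha
        refine ⟨b, hb, .inr ?_⟩
        rcases hab with rfl | hab
        · exact hta
        · exact h.so_trans _ _ _ hta hab
  · rintro ⟨a, ha, hta⟩
    simp only [committedMax, Finset.mem_filter, Finset.mem_univ, true_and] at ha
    rcases hta with rfl | hta
    · exact ha.1
    · exact hdown t a hta ha.1

/-- The maximal elements determine the commits; the transactions with a snapshot are the committed
ones together with the active ones. -/
theorem Reachable.eq_of_antichains (hS : h.Reachable S) (hS' : h.Reachable S')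
    (hmax : h.committedMax S = h.committedMax S') (hact : h.active S = h.active S') : S = S' := by
  have hC : ∀ t : Fin h.n, h.n + (t : ℕ) ∈ S ↔ h.n + (t : ℕ) ∈ S' := fun t => by
    rw [hS.committed_iff, hS'.committed_iff, hmax]
  have hA : ∀ t : Fin h.n, (t : ℕ) ∈ S ↔ (t : ℕ) ∈ S' := by
    intro t
    obtain ⟨_, _, _, H⟩ := hS.exists_schedule
    obtain ⟨_, _, _, H'⟩ := hS'.exists_schedule
    by_cases ht : h.n + (t : ℕ) ∈ S
    · exact iff_of_true (H.snapshot_mem t ht) (H'.snapshot_mem t ((hC t).1 ht))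
    · have := congrArg (t ∈ ·) hact
      simpa [active, ht, ← hC] using this
  ext e
  rcases lt_or_ge e h.n with he | he
  · exact hA ⟨e, he⟩
  · rcases lt_or_ge e (2 * h.n) with he' | he'
    · have := hC ⟨e - h.n, by omega⟩
      rwa [show h.n + (e - h.n) = e by omega] at this
    · exact iff_of_false (fun hcon => by have := Finset.mem_range.1 (hS.subset_range hcon); omega)
        (fun hcon => by have := Finset.mem_range.1 (hS'.subset_range hcon); omega)

end History

/-- Lists the set and pads with `none`. There are `(n + 1) ^ k` such functions for `n` elements,
which is where the base `n + 1` of the count comes from. -/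
theorem Finset.exists_image_option_of_card_le {α : Type*} [DecidableEq α] {k : ℕ} (s : Finset α)
    (hs : s.card ≤ k) : ∃ f : Fin k → Option α, ∀ a, a ∈ s ↔ ∃ i, f i = some a := by
  refine ⟨fun i => s.toList[(i : ℕ)]?, fun a => ?_⟩
  rw [← Finset.mem_toList, List.mem_iff_getElem?]
  refine ⟨fun ⟨i, hi⟩ => ⟨⟨i, ?_⟩, hi⟩, fun ⟨i, hi⟩ => ⟨i, hi⟩⟩
  have := (List.getElem?_eq_some_iff.1 hi).1
  rw [Finset.length_toList] at this
  omega

namespace History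

/-- There are polynomially many reachable sets of events. -/
theorem card_reachable_le {h : History} {k : ℕ} (hk : h.width ≤ k) (F : Finset (Finset ℕ))
    (hF : ∀ S ∈ F, h.Reachable S) : F.card ≤ (h.n + 1) ^ (2 * k) := by
  classical
  have hM : ∀ S, ∃ f : Fin k → Option (Fin h.n), ∀ a, a ∈ h.committedMax S ↔ ∃ i, f i = some a :=
    fun S => Finset.exists_image_option_of_card_le _ (card_committedMax_le.trans hk)
  have hA : ∀ S, h.Reachable S → ∃ f : Fin k → Option (Fin h.n), ∀ a, a ∈ h.active S ↔
      ∃ i, f i = some a :=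
    fun S hS => Finset.exists_image_option_of_card_le _ (hS.card_active_le.trans hk)
  choose fM hfM using hM
  choose fA hfA using hA
  have hinj : Function.Injective fun S : F => (fM S, fA S (hF S S.2)) := by
    intro S S' hSS'
    simp only [Prod.mk.injEq] at hSS'
    refine Subtype.ext ((hF S S.2).eq_of_antichains (hF S' S'.2) ?_ ?_)
    · ext a; rw [hfM, hfM, hSS'.1]
    · ext a; rw [hfA _ (hF S S.2), hfA _ (hF S' S'.2), hSS'.2]
  have := Fintype.card_le_of_injective _ hinj
  simpa [two_mul, pow_add] using this

end History

/-! ### Reading a history from its encoding -/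

theorem List.length_flatMap_const {α β : Type*} (l : List α) (f : α → List β) (c : ℕ)
    (hf : ∀ a ∈ l, (f a).length = c) : (l.flatMap f).length = c * l.length := by
  induction l with
  | nil => simp
  | cons a l ih =>
    rw [List.flatMap_cons, List.length_append, hf a (by simp),
      ih fun b hb => hf b (List.mem_cons_of_mem _ hb), List.length_cons]
    ring

/-- Blocks of equal length `c` make the address of an entry computable as `c * q + j`; matrix rows
and operation records are both found this way. -/
theorem List.getElem?_flatMap_const {α β : Type*} (l : List α) (f : α → List β) (c : ℕ)
    (hf : ∀ a ∈ l, (f a).length = c) (q j : ℕ) (hj : j < c) :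
    (l.flatMap f)[c * q + j]? = l[q]?.bind fun a => (f a)[j]? := by
  induction l generalizing q with
  | nil => simp
  | cons a l ih =>
    have ha := hf a (by simp)
    rw [List.flatMap_cons]
    cases q with
    | zero => simp [List.getElem?_append_left (show j < (f a).length by omega)]
    | succ q =>
      rw [List.getElem?_append_right (by rw [ha]; nlinarith), ha,
        show c * (q + 1) + j - c = c * q + j by rw [Nat.mul_succ]; omega,
        ih fun b hb => hf b (List.mem_cons_of_mem _ hb)]
      simp

namespace History

/-- The operations with their transactions, in the order of the encoding. -/
def records (h : History) : List (Fin h.n × Op) :=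
  (List.finRange h.n).flatMap fun t => (h.tx t).ops.map fun o => (t, o)

variable (h : History)

theorem mem_records {t : Fin h.n} {o : Op} : (t, o) ∈ h.records ↔ o ∈ (h.tx t).ops := by
  simp [records]

theorem length_records : h.records.length = h.numOps := by
  simp [records, numOps, List.length_flatMap]

theorem encode_eq : h.encode = h.n :: h.numOps :: (h.soCode ++
    h.records.flatMap fun p => h.opRecord p.1 p.2) := by
  simp [encode, records, List.flatMap_assoc, List.flatMap_map]

theorem length_opRecord (t : Fin h.n) (o : Op) : (h.opRecord t o).length = h.n + 5 := by
  cases o <;> simp [opRecord, Op.code]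

theorem length_soCode : h.soCode.length = h.n * h.n := by
  rw [soCode, List.length_flatMap_const (c := h.n) _ _ (by simp)]
  simp

theorem length_encode : h.encode.length = 2 + h.n * h.n + (h.n + 5) * h.numOps := by
  rw [encode_eq, List.length_cons, List.length_cons, List.length_append, length_soCode,
    List.length_flatMap_const (c := h.n + 5) _ _ (fun p _ => h.length_opRecord _ _),
    length_records]
  ring

theorem encode_so (a b : Fin h.n) :
    h.encode.getD (2 + (h.n * a + b)) 0 ≠ 0 ↔ h.so a b := by
  have hlt : h.n * (a : ℕ) + b < h.n * h.n := by nlinarith [a.2, b.2]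
  rw [encode_eq, List.getD_eq_getElem?_getD, show 2 + (h.n * (a : ℕ) + b) =
    h.n * (a : ℕ) + b + 1 + 1 by ring, List.getElem?_cons_succ, List.getElem?_cons_succ,
    List.getElem?_append_left (by rwa [length_soCode]), soCode,
    List.getElem?_flatMap_const _ _ h.n (by simp) _ _ b.2]
  simp

theorem encode_record (q j : ℕ) (hj : j < h.n + 5) :
    h.encode.getD (2 + (h.n * h.n + ((h.n + 5) * q + j))) 0 =
      ((h.records[q]?.bind fun p => (h.opRecord p.1 p.2)[j]?).getD 0) := by
  rw [encode_eq, List.getD_eq_getElem?_getD, show 2 + (h.n * h.n + ((h.n + 5) * q + j)) =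
    h.n * h.n + ((h.n + 5) * q + j) + 1 + 1 by ring, List.getElem?_cons_succ,
    List.getElem?_cons_succ, List.getElem?_append_right (by rw [length_soCode]; omega),
    length_soCode, Nat.add_sub_cancel_left, List.getElem?_flatMap_const _ _ (h.n + 5)
      (fun p _ => h.length_opRecord _ _) _ _ hj]

/-- The entry `j` of the record `q` in a memory that starts with the encoding of a history with
`n` transactions. -/
def field (n : ℕ) (m : ℕ → ℕ) (q j : ℕ) : ℕ := m (2 + (n * n + ((n + 5) * q + j)))

/-- The memory `m` starts with the encoding of the history. -/
def Stored (h : History) (m : ℕ → ℕ) : Prop :=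
  ∀ a < h.encode.length, m a = h.encode.getD a 0

variable {h} {m : ℕ → ℕ}

theorem Stored.field_eq (hm : h.Stored m) {q j : ℕ} (hq : q < h.records.length)
    (hj : j < h.n + 5) :
    field h.n m q j = ((h.opRecord h.records[q].1 h.records[q].2)[j]?).getD 0 := by
  rw [field, hm, encode_record h q j hj, List.getElem?_eq_getElem hq, Option.bind_some]
  rw [length_encode, ← length_records]
  nlinarith

theorem Stored.so_iff (hm : h.Stored m) (a b : Fin h.n) :
    m (2 + (h.n * a + b)) ≠ 0 ↔ h.so a b := by
  rw [hm, encode_so]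
  rw [length_encode]
  nlinarith [a.2, b.2]

/-- The record `q` belongs to the operation `o` of the transaction `t`. -/
structure IsRecord (h : History) (m : ℕ → ℕ) (q : ℕ) (t : Fin h.n) (o : Op) : Prop where
  mem : o ∈ (h.tx t).ops
  owner : field h.n m q 0 = t
  kind : field h.n m q 1 = 0 ↔ ∃ i x v, o = .read i x v
  var : field h.n m q 3 = o.var
  wr : ∀ a : Fin h.n, field h.n m q (a + 5) ≠ 0 ↔ h.wr a o

theorem Stored.isRecord_getElem (hm : h.Stored m) {q : ℕ} (hq : q < h.records.length) :
    h.IsRecord m q h.records[q].1 h.records[q].2 := by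
  have hf := fun j hj => hm.field_eq (j := j) hq hj
  have hmem : h.records[q] ∈ h.records := List.getElem_mem hq
  generalize h.records[q] = p at hf hmem
  obtain ⟨t, o⟩ := p
  refine ⟨h.mem_records.1 hmem, ?_, ?_, ?_, fun a => ?_⟩
  · rw [hf _ (by omega)]; simp [opRecord]
  · rw [hf _ (by omega)]; cases o <;> simp [opRecord, Op.code]
  · rw [hf _ (by omega)]; cases o <;> simp [opRecord, Op.code, Op.var]
  · rw [hf _ (by omega)]
    cases o <;> simp [opRecord, Op.code]

theorem Stored.exists_isRecord (hm : h.Stored m) {q : ℕ} (hq : q < h.numOps) :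
    ∃ t o, h.IsRecord m q t o :=
  ⟨_, _, hm.isRecord_getElem (by rwa [length_records])⟩

theorem Stored.exists_record (hm : h.Stored m) {t : Fin h.n} {o : Op} (ho : o ∈ (h.tx t).ops) :
    ∃ q < h.numOps, h.IsRecord m q t o := by
  obtain ⟨q, hq, hqo⟩ := List.mem_iff_getElem.1 (h.mem_records.2 ho)
  have := hm.isRecord_getElem hq
  rw [hqo] at this
  exact ⟨q, by rwa [← length_records], this⟩

theorem IsRecord.eq_write {q : ℕ} {t : Fin h.n} {o : Op} (hq : h.IsRecord m q t o)
    (hk : field h.n m q 1 ≠ 0) : ∃ i v, o = .write i (field h.n m q 3) v := by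
  cases o with
  | read i x v => exact absurd (hq.kind.2 ⟨i, x, v, rfl⟩) hk
  | write i x v => exact ⟨i, v, by rw [hq.var, Op.var]⟩

theorem IsRecord.eq_read {q : ℕ} {t : Fin h.n} {o : Op} (hq : h.IsRecord m q t o)
    (hk : field h.n m q 1 = 0) : ∃ i v, o = .read i (field h.n m q 3) v := by
  obtain ⟨i, x, v, rfl⟩ := hq.kind.1 hk
  exact ⟨i, v, by rw [hq.var, Op.var]⟩

theorem Stored.wrTx_iff (hm : h.Stored m) (a t : Fin h.n) : h.wrTx a t ↔
    ∃ q < h.numOps, field h.n m q 0 = t ∧ field h.n m q 1 = 0 ∧ field h.n m q (a + 5) ≠ 0 := by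
  constructor
  · rintro ⟨x, i, v, ho, hwr⟩
    obtain ⟨q, hq, hr⟩ := hm.exists_record ho
    exact ⟨q, hq, hr.owner, hr.kind.2 ⟨_, _, _, rfl⟩, (hr.wr a).2 hwr⟩
  · rintro ⟨q, hq, h0, h1, h5⟩
    obtain ⟨t', o, hr⟩ := hm.exists_isRecord hq
    obtain rfl : t' = t := Fin.ext (hr.owner.symm.trans h0)
    obtain ⟨i, v, rfl⟩ := hr.eq_read h1
    exact ⟨_, i, v, hr.mem, (hr.wr a).1 h5⟩

/-- The event `e` may happen after the events in `S`, in terms of the encoding of the history. -/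
def EnabledCode (n k : ℕ) (m : ℕ → ℕ) (S : ℕ → Prop) (e : ℕ) : Prop :=
  ¬ S e ∧ ((e < n ∧ ∀ a < n, (m (2 + (n * a + e)) ≠ 0 ∨
      ∃ q < k, field n m q 0 = e ∧ field n m q 1 = 0 ∧ field n m q (a + 5) ≠ 0) → S (n + a)) ∨
    (n ≤ e ∧ S (e - n) ∧ ∀ q < k, field n m q 0 = e - n → field n m q 1 ≠ 0 →
      ∀ q' < k, field n m q' 3 = field n m q 3 →
        (field n m q' 1 = 0 → ∀ a < n, field n m q' (a + 5) ≠ 0 → S (n + a) →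
          S (field n m q' 0)) ∧
        (field n m q' 1 ≠ 0 → field n m q' 0 ≠ e - n → S (field n m q' 0) →
          S (n + field n m q' 0))))

/-- Variables have no index range to loop over, so quantifiers over written variables become
quantifiers over write records, and reads or writes of the same variable become records with equal
variable entry. -/
theorem Stored.enabled_iff (hm : h.Stored m) (S : Finset ℕ) {e : ℕ} (he : e < 2 * h.n) :
    h.Enabled S e ↔ EnabledCode h.n h.numOps m (· ∈ S) e := by
  constructor
  · rintro ⟨t, ⟨rfl, h1, h2⟩ | ⟨rfl, h1, h2, h3⟩⟩
    · refine ⟨h1, .inl ⟨t.2, fun a ha hat => ?_⟩⟩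
      rw [hm.so_iff ⟨a, ha⟩, ← hm.wrTx_iff ⟨a, ha⟩] at hat
      exact h2 ⟨a, ha⟩ hat
    · refine ⟨h1, .inr ⟨by omega, by simpa using h2, fun q hq h0 hk q' hq' hv => ?_⟩⟩
      rw [Nat.add_sub_cancel_left] at h0 ⊢
      obtain ⟨t', o, hr⟩ := hm.exists_isRecord hq
      obtain rfl : t' = t := Fin.ext (hr.owner.symm.trans h0)
      obtain ⟨i, v, rfl⟩ := hr.eq_write hk
      obtain ⟨t₃, o', hr'⟩ := hm.exists_isRecord hq'
      obtain ⟨h4, h5⟩ := h3 _ ⟨i, v, hr.mem⟩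
      rw [hr'.owner]
      refine ⟨fun hk' a ha hwr haS => ?_, fun hk' hne ht₃ => ?_⟩
      · obtain ⟨i', v', rfl⟩ := hr'.eq_read hk'
        refine h4 ⟨a, ha⟩ t₃ ⟨i', v', ?_, ?_⟩ haS
        · rw [← hv]; exact hr'.mem
        · rw [← hv]; exact (hr'.wr ⟨a, ha⟩).1 hwr
      · obtain ⟨i', v', rfl⟩ := hr'.eq_write hk'
        refine h5 t₃ (fun hcon => hne (by rw [hcon])) ⟨i', v', ?_⟩ ht₃
        rw [← hv]; exact hr'.mem
  · rintro ⟨h1, ⟨hlt, h2⟩ | ⟨hge, h2, h3⟩⟩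
    · refine ⟨⟨e, hlt⟩, .inl ⟨rfl, h1, fun a ha => h2 a a.2 ?_⟩⟩
      rwa [hm.so_iff a ⟨e, hlt⟩, ← hm.wrTx_iff a ⟨e, hlt⟩]
    · obtain ⟨t, rfl⟩ : ∃ t : Fin h.n, e = h.n + t :=
        ⟨⟨e - h.n, by omega⟩, (Nat.add_sub_cancel' hge).symm⟩
      rw [Nat.add_sub_cancel_left] at h2 h3
      refine ⟨t, .inr ⟨rfl, h1, h2, ?_⟩⟩
      rintro x ⟨i, v, hw⟩
      obtain ⟨q, hq, hr⟩ := hm.exists_record hw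
      have hk : field h.n m q 1 ≠ 0 := fun hcon => by
        obtain ⟨_, _, _, h4⟩ := hr.kind.1 hcon
        cases h4
      refine ⟨?_, fun t₄ hne ⟨i', v', hw'⟩ ht₄ => ?_⟩
      · rintro t₁ t₃ ⟨i', v', hrd, hwr⟩ ht₁
        obtain ⟨q', hq', hr'⟩ := hm.exists_record hrd
        have := (h3 q hq hr.owner hk q' hq' (by rw [hr.var, hr'.var]; rfl)).1
          (hr'.kind.2 ⟨_, _, _, rfl⟩) t₁ t₁.2 ((hr'.wr t₁).2 hwr) ht₁
        rwa [hr'.owner] at this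
      · obtain ⟨q', hq', hr'⟩ := hm.exists_record hw'
        have := (h3 q hq hr.owner hk q' hq' (by rw [hr.var, hr'.var]; rfl)).2
          (fun hcon => by obtain ⟨_, _, _, h4⟩ := hr'.kind.1 hcon; cases h4)
        rw [hr'.owner] at this
        exact this (fun hcon => hne (Fin.ext hcon)) ht₄

/-- The test only asks about events below `2n`, because owners of records are below `n`. This
matters because memory past the end of a bit vector belongs to other data. -/
theorem Stored.enabledCode_congr (hm : h.Stored m) {P Q : ℕ → Prop}
    (hPQ : ∀ e < 2 * h.n, P e ↔ Q e) {e : ℕ} (he : e < 2 * h.n) :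
    EnabledCode h.n h.numOps m P e ↔ EnabledCode h.n h.numOps m Q e := by
  have howner : ∀ q < h.numOps, field h.n m q 0 < h.n := fun q hq => by
    obtain ⟨t, o, hr⟩ := hm.exists_isRecord hq
    rw [hr.owner]; exact t.2
  refine and_congr (not_congr (hPQ e he)) (or_congr (and_congr_right fun _ =>
    forall₂_congr fun a ha => imp_congr Iff.rfl (hPQ _ (by omega))) (and_congr_right fun _ =>
    and_congr (hPQ _ (by omega)) (forall₄_congr fun q _ _ _ => forall₃_congr fun q' hq' _ =>
    and_congr (forall₄_congr fun _ a ha _ => ?_) (forall₂_congr fun _ _ => ?_))))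
  · exact imp_congr (hPQ _ (by omega)) (hPQ _ (by have := howner q' hq'; omega))
  · exact imp_congr (hPQ _ (by have := howner q' hq'; omega))
      (hPQ _ (by have := howner q' hq'; omega))

end History

/-! ### The search program -/

namespace RAM

namespace Tm

/-- Negation of a truth value (`0` is false, all other numbers are true). -/
def not (e : Tm) : Tm := .sub (.const 1) e

/-- Disjunction. -/
def or (e f : Tm) : Tm := .add e f

/-- Conjunction. -/
def and (e f : Tm) : Tm := .not (.or (.not e) (.not f))

/-- Implication. -/
def imp (e f : Tm) : Tm := .or (.not e) f

/-- Comparison. -/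
def lt (e f : Tm) : Tm := .sub f e

/-- Equality. -/
def eq (e f : Tm) : Tm := .not (.or (.lt e f) (.lt f e))

/-- Bounded existential quantification over `R[r] = 0, …, R[b] - 1`. -/
def ex (r b : ℕ) (e : Tm) : Tm := .sum r b e

/-- Bounded universal quantification over `R[r] = 0, …, R[b] - 1`. -/
def all (r b : ℕ) (e : Tm) : Tm := .not (.ex r b (.not e))

/-- The term is true. -/
def Holds (e : Tm) (ρ m : ℕ → ℕ) : Prop := e.eval ρ m ≠ 0

variable (e f : Tm) (r b : ℕ) (ρ m : ℕ → ℕ)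

theorem holds_not : e.not.Holds ρ m ↔ ¬ e.Holds ρ m := by
  simp [Holds, not, eval]; omega

theorem holds_or : (e.or f).Holds ρ m ↔ e.Holds ρ m ∨ f.Holds ρ m := by
  simp [Holds, or, eval]; omega

theorem holds_and : (e.and f).Holds ρ m ↔ e.Holds ρ m ∧ f.Holds ρ m := by
  simp only [and, holds_not, holds_or]; tauto

theorem holds_imp : (e.imp f).Holds ρ m ↔ (e.Holds ρ m → f.Holds ρ m) := by
  simp only [imp, holds_not, holds_or]; tauto

theorem holds_lt : (e.lt f).Holds ρ m ↔ e.eval ρ m < f.eval ρ m := by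
  simp [Holds, lt, eval]; omega

theorem holds_eq : (e.eq f).Holds ρ m ↔ e.eval ρ m = f.eval ρ m := by
  simp only [eq, holds_not, holds_or, holds_lt]; omega

theorem holds_ex : (e.ex r b).Holds ρ m ↔ ∃ i < ρ b, e.Holds (Function.update ρ r i) m := by
  simp [Holds, ex, eval, Finset.sum_eq_zero_iff]

theorem holds_all : (e.all r b).Holds ρ m ↔ ∀ i < ρ b, e.Holds (Function.update ρ r i) m := by
  simp [all, holds_not, holds_ex]

theorem holds_load : (load e).Holds ρ m ↔ m (e.eval ρ m) ≠ 0 := Iff.rfl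

end Tm

/-- `reg b` times `reg r`, as a sum over the scratch register `19`. -/
def mulTm (b r : ℕ) : Tm := .sum 19 b (.reg r)

theorem eval_mulTm {b r : ℕ} (hr : r ≠ 19) (ρ m : ℕ → ℕ) :
    (mulTm b r).eval ρ m = ρ b * ρ r := by
  simp [mulTm, Tm.eval, hr]

/-- The address of the entry `e` of the bit vector with number `R[r]`. -/
def rowAddr (r : ℕ) (e : Tm) : Tm := .add (.reg 0) (.add (mulTm 3 r) e)

/-- Whether the event `e` is in the bit vector with number `R[r]`. -/
def inRow (r : ℕ) (e : Tm) : Tm := .load (rowAddr r e)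

/-- The entry `j` of the record with number `R[q]`. -/
def fieldTm (q : ℕ) (j : Tm) : Tm :=
  .load (.add (.const 2) (.add (mulTm 1 1) (.add (mulTm 4 q) j)))

/-- The entry of the matrix of the session order in row `R[a]` and column `R[b]`. -/
def soTm (a b : ℕ) : Tm := .load (.add (.const 2) (.add (mulTm 1 a) (.reg b)))

/-- Whether the event `R[8]` may happen after the events in the bit vector with number `R[7]`. -/
def enabledTm : Tm :=
  .and (.not (inRow 7 (.reg 8))) <| .or
    (.and (.lt (.reg 8) (.reg 1)) <| .all 11 1 <| .imp
      (.or (soTm 11 8) <| .ex 12 2 <| .and (.eq (fieldTm 12 (.const 0)) (.reg 8)) <|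
        .and (.not (fieldTm 12 (.const 1))) (fieldTm 12 (.add (.reg 11) (.const 5))))
      (inRow 7 (.add (.reg 1) (.reg 11))))
    (.and (.not (.lt (.reg 8) (.reg 1))) <| .and (inRow 7 (.sub (.reg 8) (.reg 1))) <|
      .all 11 2 <| .imp (.eq (fieldTm 11 (.const 0)) (.sub (.reg 8) (.reg 1))) <|
      .imp (fieldTm 11 (.const 1)) <|
      .all 12 2 <| .imp (.eq (fieldTm 12 (.const 3)) (fieldTm 11 (.const 3))) <| .and
        (.imp (.not (fieldTm 12 (.const 1))) <| .all 13 1 <|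
          .imp (fieldTm 12 (.add (.reg 13) (.const 5))) <|
          .imp (inRow 7 (.add (.reg 1) (.reg 13))) (inRow 7 (fieldTm 12 (.const 0))))
        (.imp (fieldTm 12 (.const 1)) <|
          .imp (.not (.eq (fieldTm 12 (.const 0)) (.sub (.reg 8) (.reg 1)))) <|
          .imp (inRow 7 (fieldTm 12 (.const 0)))
            (inRow 7 (.add (.reg 1) (fieldTm 12 (.const 0))))))

/-- Whether the bit vector with number `R[6]` is equal to one with a smaller number. -/
def duplicateTm : Tm :=
  .ex 11 5 <| .and (.lt (.reg 11) (.reg 6)) <| .all 12 3 <| .and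
    (.imp (inRow 11 (.reg 12)) (inRow 6 (.reg 12))) (.imp (inRow 6 (.reg 12)) (inRow 11 (.reg 12)))

/-- Writes the bit vector with number `R[7]`, with the event `R[8]` inserted, to the place with
number `R[6]`. -/
def insertCmd : Cmd :=
  .forTo 9 3 <| .store (rowAddr 6 (.reg 9)) (.or (inRow 7 (.reg 9)) (.eq (.reg 9) (.reg 8)))

/-- Adds the result of the event `R[8]` in the bit vector with number `R[7]` to the list. -/
def extendCmd : Cmd :=
  .ite enabledTm <| .seq insertCmd <|
    .ite (.not duplicateTm) <| .assign 6 (.add (.reg 6) (.const 1))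

/-- Lists all reachable sets of events and checks whether one of them is full. -/
def searchCmd : Cmd :=
  .seq (.assign 6 (.const 1)) <|
  .seq (.forTo 7 5 <| .ite (.lt (.reg 7) (.reg 6)) <| .forTo 8 3 extendCmd) <|
  .assign 10 <| .ex 11 5 <| .and (.lt (.reg 11) (.reg 6)) <| .all 12 3 <| inRow 11 (.reg 12)

/-- Registers `0` to `5` are the protected ones: input length, number of transactions, number of
operations, number of events, record length, table bound. Register `6` is the table length, `7` and
`8` the current set and event, `9` the copying index, `10` the answer, `11` to `13` quantified
variables, `19` the index of multiplications. Scratch space can start at `20`. -/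
theorem searchCmd_WF : searchCmd.WF 6 20 := by decide

/-- The bit vector with number `r`, of length `w`, in a table that starts at address `L`. -/
def row (L w : ℕ) (m : ℕ → ℕ) (r : ℕ) : Finset ℕ :=
  (Finset.range w).filter fun e => m (L + (w * r + e)) ≠ 0

theorem holds_enabledTm (ρ m : ℕ → ℕ) (h4 : ρ 4 = ρ 1 + 5) :
    enabledTm.Holds ρ m ↔
      History.EnabledCode (ρ 1) (ρ 2) m (fun e => m (ρ 0 + (ρ 3 * ρ 7 + e)) ≠ 0) (ρ 8) := by
  simp only [enabledTm, inRow, rowAddr, fieldTm, soTm, Tm.holds_and, Tm.holds_or, Tm.holds_not,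
    Tm.holds_imp, Tm.holds_all, Tm.holds_ex, Tm.holds_eq, Tm.holds_lt, Tm.holds_load, Tm.eval,
    eval_mulTm, Function.update_apply, ne_eq, Nat.reduceEqDiff, if_false,
    if_true, not_false_eq_true, History.EnabledCode, History.field, h4, not_lt, 
    OfNat.one_ne_ofNat, OfNat.zero_ne_ofNat, not_not, add_zero]

theorem mem_row {L w : ℕ} {m : ℕ → ℕ} {r e : ℕ} :
    e ∈ row L w m r ↔ e < w ∧ m (L + (w * r + e)) ≠ 0 := by
  simp [row]

theorem holds_duplicateTm (ρ m : ℕ → ℕ) :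
    duplicateTm.Holds ρ m ↔
      ∃ r < ρ 5, r < ρ 6 ∧ row (ρ 0) (ρ 3) m r = row (ρ 0) (ρ 3) m (ρ 6) := by
  simp only [duplicateTm, inRow, rowAddr, Tm.holds_and, Tm.holds_imp, Tm.holds_all, Tm.holds_ex,
    Tm.holds_lt, Tm.holds_load, Tm.eval, eval_mulTm, Function.update_apply, ne_eq,
    Nat.reduceEqDiff, if_false, if_true, not_false_eq_true, OfNat.zero_ne_ofNat]
  refine exists_congr fun r => and_congr_right fun _ => and_congr_right fun _ => ?_
  rw [Finset.ext_iff]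
  simp only [mem_row]
  refine ⟨fun H e => and_congr_right fun he => ⟨(H e he).1, (H e he).2⟩, fun H e he => ?_⟩
  have := H e
  simp only [he, true_and] at this
  exact ⟨this.1, this.2⟩

/-! ### Correctness of the search -/

theorem State.setReg_self (s : State) (q v : ℕ) : (s.setReg q v).reg q = v := by
  simp [State.setReg]

theorem State.setReg_of_ne (s : State) {p q : ℕ} (hpq : p ≠ q) (v : ℕ) :
    (s.setReg q v).reg p = s.reg p := by
  simp [State.setReg, hpq]

theorem rec_induction {P : ℕ → State → Prop} {f : ℕ → State → State} {s : State} {N : ℕ}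
    (h0 : P 0 s) (hstep : ∀ i < N, ∀ s, P i s → P (i + 1) (f i s)) :
    P N (Nat.rec s (fun i s' => f i s') N : State) := by
  have : ∀ i ≤ N, P i (Nat.rec s (fun i s' => f i s') i : State) := by
    intro i
    induction i with
    | zero => exact fun _ => h0
    | succ i ih => exact fun hi => hstep i hi _ (ih (by omega))
  exact this N le_rfl

theorem exec_ite_pos {e : Tm} {c : Cmd} {s : State} (he : e.Holds s.reg s.mem) :
    (Cmd.ite e c).exec s = c.exec s := if_pos he

theorem exec_ite_neg {e : Tm} {c : Cmd} {s : State} (he : ¬ e.Holds s.reg s.mem) :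
    (Cmd.ite e c).exec s = s := if_neg he

/-- The source has a smaller number than the target, so their address ranges are disjoint and the
source is intact while it is copied. Every entry of the target is overwritten, so its previous
contents are irrelevant. -/
theorem exec_insertCmd (σ : State) (h76 : σ.reg 7 < σ.reg 6) :
    (∀ q, q ≠ 9 → (insertCmd.exec σ).reg q = σ.reg q) ∧
    (∀ a < σ.reg 0 + σ.reg 3 * σ.reg 6, (insertCmd.exec σ).mem a = σ.mem a) ∧
    (σ.reg 8 < σ.reg 3 → row (σ.reg 0) (σ.reg 3) (insertCmd.exec σ).mem (σ.reg 6) =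
      insert (σ.reg 8) (row (σ.reg 0) (σ.reg 3) σ.mem (σ.reg 7))) := by
  have hic : σ.reg 3 * σ.reg 7 + σ.reg 3 ≤ σ.reg 3 * σ.reg 6 := by nlinarith
  have key : (∀ q, q ≠ 9 → (insertCmd.exec σ).reg q = σ.reg q) ∧
      (∀ a < σ.reg 0 + σ.reg 3 * σ.reg 6, (insertCmd.exec σ).mem a = σ.mem a) ∧
      ∀ j < σ.reg 3, (insertCmd.exec σ).mem (σ.reg 0 + (σ.reg 3 * σ.reg 6 + j)) ≠ 0 ↔
        σ.mem (σ.reg 0 + (σ.reg 3 * σ.reg 7 + j)) ≠ 0 ∨ j = σ.reg 8 := by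
    refine rec_induction (P := fun k τ => (∀ q, q ≠ 9 → τ.reg q = σ.reg q) ∧
      (∀ a < σ.reg 0 + σ.reg 3 * σ.reg 6, τ.mem a = σ.mem a) ∧
      ∀ j < k, τ.mem (σ.reg 0 + (σ.reg 3 * σ.reg 6 + j)) ≠ 0 ↔ σ.mem (σ.reg 0 + (σ.reg 3 * σ.reg 7 + j)) ≠ 0 ∨ j = σ.reg 8)
      (by simp) ?_
    rintro k hk τ ⟨h1, h2, h3⟩
    have hreg : ∀ q, q ≠ 9 → (τ.setReg 9 k).reg q = σ.reg q := fun q hq => by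
      simp [State.setReg, hq, h1 q hq]
    have haddr : (rowAddr 6 (.reg 9)).eval (τ.setReg 9 k).reg τ.mem = σ.reg 0 + (σ.reg 3 * σ.reg 6 + k) := by
      simp only [rowAddr, Tm.eval, eval_mulTm (show 6 ≠ 19 by decide), hreg 0 (by decide),
        hreg 3 (by decide), hreg 6 (by decide)]
      simp [State.setReg]
    have hval : (Tm.or (inRow 7 (.reg 9)) (.eq (.reg 9) (.reg 8))).eval (τ.setReg 9 k).reg τ.mem
        ≠ 0 ↔ σ.mem (σ.reg 0 + (σ.reg 3 * σ.reg 7 + k)) ≠ 0 ∨ k = σ.reg 8 := by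
      change Tm.Holds _ _ _ ↔ _
      rw [Tm.holds_or, Tm.holds_eq, inRow, Tm.holds_load]
      simp only [rowAddr, Tm.eval, eval_mulTm (show 7 ≠ 19 by decide), hreg 0 (by decide),
        hreg 3 (by decide), hreg 7 (by decide), hreg 8 (by decide)]
      rw [show (τ.setReg 9 k).reg 9 = k by simp [State.setReg], h2 _ (by omega)]
    refine ⟨hreg, fun a ha => ?_, fun j hj => ?_⟩
    · rw [← h2 a ha]
      refine Function.update_of_ne ?_ _ _
      change a ≠ (rowAddr 6 (.reg 9)).eval (τ.setReg 9 k).reg τ.mem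
      omega
    · change Function.update τ.mem ((rowAddr 6 (.reg 9)).eval (τ.setReg 9 k).reg τ.mem)
        ((Tm.or (inRow 7 (.reg 9)) (.eq (.reg 9) (.reg 8))).eval (τ.setReg 9 k).reg τ.mem)
        (σ.reg 0 + (σ.reg 3 * σ.reg 6 + j)) ≠ 0 ↔ _
      rw [haddr]
      rcases Nat.lt_succ_iff_lt_or_eq.1 hj with hj | rfl
      · rw [Function.update_of_ne (by omega), h3 j hj]
      · rw [Function.update_self, hval]
  refine ⟨key.1, key.2.1, fun he => ?_⟩
  ext j
  simp only [Finset.mem_insert, mem_row]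
  refine ⟨fun ⟨hj, hj'⟩ => ?_, ?_⟩
  · rcases (key.2.2 j hj).1 hj' with h1 | h1
    · exact .inr ⟨hj, h1⟩
    · exact .inl h1
  · rintro (rfl | ⟨hj, hj'⟩)
    · exact ⟨he, (key.2.2 _ he).2 (.inr rfl)⟩
    · exact ⟨hj, (key.2.2 _ hj).2 (.inl hj')⟩

/-- The invariant of the search: the input is unchanged, and the table lists different reachable
sets of events, the first of which is empty. -/
structure Inv (h : History) (N : ℕ) (σ : State) : Prop where
  reg_zero : σ.reg 0 = h.encode.length
  reg_one : σ.reg 1 = h.n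
  reg_two : σ.reg 2 = h.numOps
  reg_three : σ.reg 3 = 2 * h.n
  reg_four : σ.reg 4 = h.n + 5
  reg_five : σ.reg 5 = N
  stored : h.Stored σ.mem
  pos : 0 < σ.reg 6
  row_zero : row h.encode.length (2 * h.n) σ.mem 0 = ∅
  reachable : ∀ r < σ.reg 6, h.Reachable (row h.encode.length (2 * h.n) σ.mem r)
  inj : ∀ r < σ.reg 6, ∀ r' < σ.reg 6, row h.encode.length (2 * h.n) σ.mem r =
    row h.encode.length (2 * h.n) σ.mem r' → r = r'

/-- The table is only extended. -/
structure Extends (h : History) (σ σ' : State) : Prop where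
  le : σ.reg 6 ≤ σ'.reg 6
  row_eq : ∀ r < σ.reg 6, row h.encode.length (2 * h.n) σ'.mem r =
    row h.encode.length (2 * h.n) σ.mem r

/-- The table contains the result of the event `e` in the set number `i`, if it may happen. -/
def Closed (h : History) (σ : State) (i e : ℕ) : Prop :=
  h.Enabled (row h.encode.length (2 * h.n) σ.mem i) e → ∃ r < σ.reg 6,
    row h.encode.length (2 * h.n) σ.mem r =
      insert e (row h.encode.length (2 * h.n) σ.mem i)

variable {h : History} {N : ℕ} {σ σ' σ'' : State}

theorem Extends.trans (h₁ : Extends h σ σ') (h₂ : Extends h σ' σ'') : Extends h σ σ'' :=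
  ⟨h₁.le.trans h₂.le, fun r hr => (h₂.row_eq r (hr.trans_le h₁.le)).trans (h₁.row_eq r hr)⟩

theorem Closed.extend {i e : ℕ} (hc : Closed h σ i e) (hi : i < σ.reg 6)
    (hσ : Extends h σ σ') : Closed h σ' i e := by
  intro he
  rw [hσ.row_eq i hi] at he ⊢
  obtain ⟨r, hr, hrow⟩ := hc he
  exact ⟨r, hr.trans_le hσ.le, (hσ.row_eq r hr).trans hrow⟩

/-- The table lists distinct reachable sets, so the count bounds its length. Loops up to `N`
therefore cover the whole table. -/
theorem Inv.reg_six_le {k : ℕ} (hσ : Inv h N σ) (hk : h.width ≤ k)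
    (hN : (h.n + 1) ^ (2 * k) ≤ N) : σ.reg 6 ≤ N := by
  have hcard := History.card_reachable_le hk
    ((Finset.range (σ.reg 6)).image (row h.encode.length (2 * h.n) σ.mem)) (by
      intro S hS
      obtain ⟨r, hr, rfl⟩ := Finset.mem_image.1 hS
      exact hσ.reachable r (Finset.mem_range.1 hr))
  rw [Finset.card_image_of_injOn, Finset.card_range] at hcard
  · exact hcard.trans hN
  · intro r hr r' hr' heq
    simp only [Finset.coe_range, Set.mem_Iio] at hr hr'
    exact hσ.inj r hr r' hr' heq

theorem Inv.setReg (hσ : Inv h N σ) {q v : ℕ} (hq : 6 < q) : Inv h N (σ.setReg q v) := by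
  have hreg : ∀ p ≤ 6, (σ.setReg q v).reg p = σ.reg p := fun p hp =>
    Function.update_of_ne (by omega) _ _
  obtain ⟨h0, h1, h2, h3, h4, h5, h6, h7, h8, h9, h10⟩ := hσ
  constructor <;> (try rw [hreg _ (by omega)]) <;> assumption

theorem Inv.holds_enabledTm_iff (hσ : Inv h N σ) (he : σ.reg 8 < 2 * h.n) :
    enabledTm.Holds σ.reg σ.mem ↔
      h.Enabled (row h.encode.length (2 * h.n) σ.mem (σ.reg 7)) (σ.reg 8) := by
  rw [holds_enabledTm _ _ (by rw [hσ.reg_four, hσ.reg_one]), hσ.stored.enabled_iff _ he,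
    hσ.reg_one, hσ.reg_two]
  refine hσ.stored.enabledCode_congr (fun e he => ?_) he
  rw [mem_row, hσ.reg_zero, hσ.reg_three]
  simp [he]

theorem exec_extendCmd {k : ℕ} (hσ : Inv h N σ) (hk : h.width ≤ k)
    (hN : (h.n + 1) ^ (2 * k) ≤ N) (h76 : σ.reg 7 < σ.reg 6) (he : σ.reg 8 < 2 * h.n) :
    Inv h N (extendCmd.exec σ) ∧ Extends h σ (extendCmd.exec σ) ∧
      (extendCmd.exec σ).reg 7 = σ.reg 7 ∧
      Closed h (extendCmd.exec σ) (σ.reg 7) (σ.reg 8) := by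
  by_cases hen : enabledTm.Holds σ.reg σ.mem
  swap
  · have : extendCmd.exec σ = σ := if_neg hen
    rw [this]
    exact ⟨hσ, ⟨le_rfl, fun _ _ => rfl⟩, rfl, fun hcon =>
      absurd ((hσ.holds_enabledTm_iff he).2 hcon) hen⟩
  have hen' := (hσ.holds_enabledTm_iff he).1 hen
  have hexec : extendCmd.exec σ =
      (Cmd.ite (.not duplicateTm) (.assign 6 (.add (.reg 6) (.const 1)))).exec
        (insertCmd.exec σ) := exec_ite_pos hen
  obtain ⟨hreg, hmem, hrow⟩ := exec_insertCmd σ h76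
  rw [hσ.reg_zero, hσ.reg_three] at hmem hrow
  replace hrow := hrow he
  set τ := insertCmd.exec σ with hτ
  have hrow' : ∀ r < σ.reg 6, row h.encode.length (2 * h.n) τ.mem r =
      row h.encode.length (2 * h.n) σ.mem r := fun r hr => by
    ext j
    rw [mem_row, mem_row]
    refine and_congr_right fun hj => ?_
    rw [hmem _ (by nlinarith)]
  have hreg6 : τ.reg 6 = σ.reg 6 := hreg 6 (by decide)
  have hstored : h.Stored τ.mem := fun a ha => by
    rw [hmem a (by omega)]; exact hσ.stored a ha
  have hτσ : Extends h σ τ := ⟨hreg6.ge, hrow'⟩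
  have hinv : Inv h N τ := by
    constructor
    · rw [hreg 0 (by decide), hσ.reg_zero]
    · rw [hreg 1 (by decide), hσ.reg_one]
    · rw [hreg 2 (by decide), hσ.reg_two]
    · rw [hreg 3 (by decide), hσ.reg_three]
    · rw [hreg 4 (by decide), hσ.reg_four]
    · rw [hreg 5 (by decide), hσ.reg_five]
    · exact hstored
    · rw [hreg6]; exact hσ.pos
    · rw [hrow' 0 hσ.pos, hσ.row_zero]
    · intro r hr
      rw [hreg6] at hr
      rw [hrow' r hr]; exact hσ.reachable r hr
    · intro r hr r' hr' heq
      rw [hreg6] at hr hr'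
      rw [hrow' r hr, hrow' r' hr'] at heq
      exact hσ.inj r hr r' hr' heq
  have hdup := holds_duplicateTm τ.reg τ.mem
  rw [hinv.reg_zero, hinv.reg_three, hinv.reg_five, hreg6, hrow] at hdup
  -- For a duplicate the length does not advance: the copy stays beyond the end of the table and has
  -- no effect on the listed sets.
  by_cases hd : duplicateTm.Holds τ.reg τ.mem
  · rw [exec_ite_neg ((Tm.holds_not _ _ _).not.2 (not_not.2 hd))] at hexec
    rw [hexec]
    refine ⟨hinv, hτσ, hreg 7 (by decide), fun _ => ?_⟩
    obtain ⟨r, -, hr, heq⟩ := hdup.1 hd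
    exact ⟨r, hr.trans_le hτσ.le, by rw [heq, hrow' _ h76]⟩
  · rw [exec_ite_pos ((Tm.holds_not _ _ _).2 hd)] at hexec
    have hnew : ∀ r < σ.reg 6, row h.encode.length (2 * h.n) σ.mem r ≠
        insert (σ.reg 8) (row h.encode.length (2 * h.n) σ.mem (σ.reg 7)) := fun r hr heq =>
      hd (hdup.2 ⟨r, hr.trans_le (hσ.reg_six_le hk hN), hr, by rw [hrow' r hr, heq]⟩)
    have hmem' : (extendCmd.exec σ).mem = τ.mem := by rw [hexec]; rfl
    have hreg' : ∀ q, q ≠ 6 → (extendCmd.exec σ).reg q = τ.reg q := fun q hq => by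
      rw [hexec]; exact Function.update_of_ne hq _ _
    have hreg6' : (extendCmd.exec σ).reg 6 = σ.reg 6 + 1 := by
      rw [hexec, ← hreg6]; exact State.setReg_self _ _ _
    have hext : Extends h σ (extendCmd.exec σ) :=
      ⟨by omega, fun r hr => by rw [hmem', hrow' r hr]⟩
    refine ⟨?_, hext, by rw [hreg' 7 (by decide), hreg 7 (by decide)], fun _ =>
      ⟨σ.reg 6, by omega, by rw [hmem', hrow, hrow' _ h76]⟩⟩
    constructor
    · rw [hreg' 0 (by decide), hinv.reg_zero]
    · rw [hreg' 1 (by decide), hinv.reg_one]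
    · rw [hreg' 2 (by decide), hinv.reg_two]
    · rw [hreg' 3 (by decide), hinv.reg_three]
    · rw [hreg' 4 (by decide), hinv.reg_four]
    · rw [hreg' 5 (by decide), hinv.reg_five]
    · rw [hmem']; exact hstored
    · omega
    · rw [hmem']; exact hinv.row_zero
    · intro r hr
      rw [hmem']
      rcases Nat.lt_succ_iff_lt_or_eq.1 (hreg6' ▸ hr) with hr | rfl
      · exact hinv.reachable r (by omega)
      · rw [hrow]
        exact (hσ.reachable _ h76).tail ⟨_, hen', rfl⟩
    · intro r hr r' hr' heq
      rw [hmem'] at heq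
      rcases Nat.lt_succ_iff_lt_or_eq.1 (hreg6' ▸ hr) with hr | rfl <;>
        rcases Nat.lt_succ_iff_lt_or_eq.1 (hreg6' ▸ hr') with hr' | rfl
      · exact hinv.inj r (by omega) r' (by omega) heq
      · exact absurd (by rw [← hrow, ← heq, hrow' r hr]) (hnew r hr)
      · exact absurd (by rw [← hrow, heq, hrow' r' hr']) (hnew r' hr')
      · rfl

theorem exec_searchCmd {k : ℕ} (hk : h.width ≤ k) (hN : (h.n + 1) ^ (2 * k) ≤ N)
    (hσ : Inv h N (σ.setReg 6 1)) :
    (searchCmd.exec σ).reg 10 ≠ 0 ↔ h.SnapshotIsolation := by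
  -- After `i` rounds all listed sets with number below `i` are closed under enabled events. New
  -- sets are appended, so their turn comes later; rounds with `i` beyond the table do nothing.
  have key := rec_induction (N := N) (s := σ.setReg 6 1)
    (f := fun i s => (Cmd.ite (.lt (.reg 7) (.reg 6)) (.forTo 8 3 extendCmd)).exec (s.setReg 7 i))
    (P := fun i s => Inv h N s ∧ ∀ r < i, r < s.reg 6 → ∀ e < 2 * h.n, Closed h s r e)
    ⟨hσ, by simp⟩ (by
      rintro i hi s ⟨hs, hcl⟩
      have hs' := hs.setReg (q := 7) (v := i) (by decide)
      have hlt := Tm.holds_lt (.reg 7) (.reg 6) (s.setReg 7 i).reg (s.setReg 7 i).mem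
      simp only [Tm.eval, State.setReg, Function.update_self] at hlt
      by_cases hi6 : i < s.reg 6
      · rw [exec_ite_pos (hlt.2 hi6)]
        have hinner := rec_induction (N := (s.setReg 7 i).reg 3) (s := s.setReg 7 i)
          (f := fun e s => extendCmd.exec (s.setReg 8 e))
          (P := fun e s' => Inv h N s' ∧ Extends h s s' ∧ s'.reg 7 = i ∧
            ∀ e' < e, Closed h s' i e')
          ⟨hs', ⟨le_rfl, fun _ _ => rfl⟩, State.setReg_self _ _ _, by simp⟩ (by
            rintro e he s' ⟨hs', hext, h7, hcl'⟩
            have hr7 : (s'.setReg 8 e).reg 7 = i := h7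
            have hr6 : (s'.setReg 8 e).reg 6 = s'.reg 6 := rfl
            have hr8 : (s'.setReg 8 e).reg 8 = e := State.setReg_self _ _ _
            rw [show (s.setReg 7 i).reg 3 = s.reg 3 from rfl, hs.reg_three] at he
            obtain ⟨h1, h2, h3, h4⟩ := exec_extendCmd (hs'.setReg (q := 8) (v := e) (by decide))
              hk hN (by rw [hr7, hr6]; exact hi6.trans_le hext.le) (by rwa [hr8])
            rw [hr7, hr8] at h4
            have h2' : Extends h s' (extendCmd.exec (s'.setReg 8 e)) := ⟨h2.le, h2.row_eq⟩
            refine ⟨h1, hext.trans h2', h3.trans hr7, fun e' he' => ?_⟩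
            rcases Nat.lt_succ_iff_lt_or_eq.1 he' with he' | rfl
            · exact (hcl' e' he').extend (hi6.trans_le hext.le) h2'
            · exact h4)
        rw [show (s.setReg 7 i).reg 3 = 2 * h.n from hs.reg_three] at hinner
        obtain ⟨h1, h2, -, h3⟩ := hinner
        rw [Cmd.exec, show (s.setReg 7 i).reg 3 = 2 * h.n from hs.reg_three]
        refine ⟨h1, fun r hr _ e he => ?_⟩
        rcases Nat.lt_succ_iff_lt_or_eq.1 hr with hr | rfl
        · exact (hcl r hr (hr.trans hi6) e he).extend (hr.trans hi6) h2
        · exact h3 e he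
      · rw [exec_ite_neg (hlt.not.2 hi6)]
        exact ⟨hs', fun r _ hr6 => hcl r (by
          have : r < s.reg 6 := hr6
          omega) hr6⟩)
  have hexec : (searchCmd.exec σ) = (Cmd.assign 10 (.ex 11 5 <| .and (.lt (.reg 11) (.reg 6)) <|
      .all 12 3 <| inRow 11 (.reg 12))).exec (Nat.rec (σ.setReg 6 1) (fun i s =>
      (Cmd.ite (.lt (.reg 7) (.reg 6)) (.forTo 8 3 extendCmd)).exec (s.setReg 7 i)) N) := by
    rw [← show (σ.setReg 6 1).reg 5 = N from hσ.reg_five]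
    rfl
  rw [hexec]
  generalize (Nat.rec (σ.setReg 6 1) (fun i s =>
    (Cmd.ite (.lt (.reg 7) (.reg 6)) (.forTo 8 3 extendCmd)).exec (s.setReg 7 i)) N : State) = τ
    at key
  obtain ⟨hτ, hcl⟩ := key
  -- The table has at most `N` entries, so after `N` rounds every listed set has been processed.
  have hle := hτ.reg_six_le hk hN
  have hans : ((Cmd.assign 10 (.ex 11 5 <| .and (.lt (.reg 11) (.reg 6)) <|
      .all 12 3 <| inRow 11 (.reg 12))).exec τ).reg 10 ≠ 0 ↔ ∃ r < τ.reg 6, ∀ e < 2 * h.n,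
      e ∈ row h.encode.length (2 * h.n) τ.mem r := by
    rw [Cmd.exec, State.setReg_self]
    change Tm.Holds _ _ _ ↔ _
    simp only [inRow, rowAddr, Tm.holds_and, Tm.holds_all, Tm.holds_ex, Tm.holds_lt,
      Tm.holds_load, Tm.eval, eval_mulTm, Function.update_apply, ne_eq, Nat.reduceEqDiff, if_false,
      if_true, not_false_eq_true, OfNat.zero_ne_ofNat, hτ.reg_zero, hτ.reg_three, hτ.reg_five,
      mem_row]
    exact ⟨fun ⟨r, _, hr, H⟩ => ⟨r, hr, fun e he => ⟨he, H e he⟩⟩,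
      fun ⟨r, hr, H⟩ => ⟨r, by omega, hr, fun e he => (H e he).2⟩⟩
  rw [hans, History.snapshotIsolation_iff]
  constructor
  · rintro ⟨r, hr, H⟩
    exact ⟨_, hτ.reachable r hr, H⟩
  · rintro ⟨S, hS, H⟩
    -- The table contains `∅` and is closed under steps, hence contains every reachable set.
    have hlist : ∀ S, h.Reachable S → ∃ r < τ.reg 6,
        row h.encode.length (2 * h.n) τ.mem r = S := by
      intro S hS
      induction hS with
      | refl => exact ⟨0, hτ.pos, hτ.row_zero⟩
      | tail _ hstep ih =>
        obtain ⟨r, hr, rfl⟩ := ih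
        obtain ⟨e, he, rfl⟩ := hstep
        exact hcl r (by omega) hr e (by
          obtain ⟨t, ⟨rfl, -⟩ | ⟨rfl, -⟩⟩ := he <;> omega) he
    obtain ⟨r, hr, rfl⟩ := hlist S hS
    exact ⟨r, hr, H⟩

/-! ### Setup and the polynomial time bound -/

/-- Stores the number of transactions, the number of operations, the number of events, and the
length of a record. -/
def setupCmd : Cmd :=
  .seq (.assign 1 (.load (.const 0))) <| .seq (.assign 2 (.load (.const 1))) <|
  .seq (.assign 3 (.add (.reg 1) (.reg 1))) (.assign 4 (.add (.reg 1) (.const 5)))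

/-- Computes the `j`-th power of `R[4]`. -/
def powCmd : ℕ → Cmd
  | 0 => .assign 5 (.const 1)
  | j + 1 => .seq (powCmd j) (.assign 5 (mulTm 4 5))

/-- Only registers below `5` are protected here, since `5` is being computed. The multiplications
loop over register `4`, not over the growing power. -/
theorem powCmd_WF (j : ℕ) : (powCmd j).WF 5 20 := by
  induction j with
  | zero => decide
  | succ j ih => exact ⟨ih, by decide⟩

theorem exec_powCmd (j : ℕ) (σ : State) :
    (powCmd j).exec σ = σ.setReg 5 (σ.reg 4 ^ j) := by
  induction j with
  | zero => rfl
  | succ j ih =>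
    rw [powCmd, Cmd.exec, ih, Cmd.exec, eval_mulTm (by decide)]
    simp [State.setReg, pow_succ']

theorem length_le_bitSize (l : List ℕ) : l.length ≤ bitSize l := by
  induction l with
  | nil => simp
  | cons a l ih => simp only [bitSize, List.map_cons, List.sum_cons, List.length_cons] at ih ⊢; omega

end RAM

theorem mainTheorem10 (k : ℕ) :
    RAM.PolyTimeDecidable (fun h : {h : History // h.width ≤ k} => h.1.encode)
      (fun h => h.1.SnapshotIsolation) := by
  open RAM Polynomial in
  -- The three phases protect `1`, `5` and `6` registers, with bounds `S`, `2S + 5` and `2S + 5 + (S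
  -- + 5) ^ (2k)` for input size `S`; the costs are composed with these bounds.
  refine ⟨.seq (setupCmd.compile 20) <| .seq ((powCmd (2 * k)).compile 20) <|
    .seq (searchCmd.compile 20) (.copy 0 10),
    setupCmd.cost + (powCmd (2 * k)).cost.comp (2 * X + 5) +
      searchCmd.cost.comp (2 * X + 5 + (X + 5) ^ (2 * k)) + 1, ?_⟩
  rintro ⟨h, hk⟩
  set l := h.encode with hl
  set S := RAM.bitSize l
  have hS : l.length ≤ S := RAM.length_le_bitSize l
  have hlen := h.length_encode
  have hn : h.n ≤ S := by nlinarith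
  have hm : h.numOps ≤ S := by nlinarith
  set σ₀ := RAM.initState l with hσ₀
  obtain ⟨t₁, s₁, run₁, ht₁, hm₁, hr₁, -⟩ := RAM.Cmd.compile_run (κ := 1) (D := 20) (B := S)
    (by decide) RAM.setupCmd (by decide) 20 le_rfl σ₀ σ₀ rfl (fun _ _ => rfl) (fun q hq => by
      obtain rfl : q = 0 := by omega
      exact hS)
  set σ₁ := RAM.setupCmd.exec σ₀ with hσ₁
  have h10 : σ₁.reg 0 = l.length := rfl
  have h11 : σ₁.reg 1 = h.n := rfl
  have h12 : σ₁.reg 2 = h.numOps := rfl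
  have h13 : σ₁.reg 3 = 2 * h.n := (two_mul h.n).symm
  have h14 : σ₁.reg 4 = h.n + 5 := rfl
  have hB₁ : ∀ q < 5, σ₁.reg q ≤ 2 * S + 5 := fun q hq => by
    interval_cases q <;> omega
  obtain ⟨t₂, s₂, run₂, ht₂, hm₂, hr₂, -⟩ := RAM.Cmd.compile_run (κ := 5) (D := 20)
    (B := 2 * S + 5) (by decide) (RAM.powCmd (2 * k)) (RAM.powCmd_WF _) 20 le_rfl s₁ σ₁ hm₁ hr₁ hB₁
  rw [RAM.exec_powCmd, h14] at hm₂ hr₂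
  -- The base `n + 5` is already in register `4`; it exceeds the required `n + 1`.
  set N := (h.n + 5) ^ (2 * k) with hN
  have hB₂ : ∀ q < 6, (σ₁.setReg 5 N).reg q ≤ 2 * S + 5 + (S + 5) ^ (2 * k) := fun q hq => by
    have hNS : N ≤ (S + 5) ^ (2 * k) := Nat.pow_le_pow_left (by omega) _
    by_cases hq5 : q = 5
    · subst hq5
      exact (σ₁.setReg_self 5 N).le.trans (hNS.trans (by omega))
    · exact (σ₁.setReg_of_ne hq5 N).le.trans ((hB₁ q (by omega)).trans (by omega))
  obtain ⟨t₃, s₃, run₃, ht₃, hm₃, hr₃, -⟩ := RAM.Cmd.compile_run (κ := 6) (D := 20)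
    (B := 2 * S + 5 + (S + 5) ^ (2 * k)) (by decide) RAM.searchCmd RAM.searchCmd_WF 20 le_rfl s₂
    (σ₁.setReg 5 N) hm₂ hr₂ hB₂
  -- Memory after the input is zero, so the table at address `l.length` initially holds the empty
  -- set as its entry `0`.
  have hrow : RAM.row l.length (2 * h.n) σ₀.mem 0 = ∅ := by
    ext e
    simp [RAM.mem_row, hσ₀, RAM.initState]
  have hinv : RAM.Inv h N ((σ₁.setReg 5 N).setReg 6 1) := by
    refine ⟨h10, h11, h12, h13, h14, rfl, fun a _ => rfl, Nat.one_pos, hrow, ?_, ?_⟩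
    · intro r hr
      obtain rfl : r = 0 := Nat.lt_one_iff.1 hr
      exact hrow ▸ Relation.ReflTransGen.refl
    · intro r hr r' hr' _
      rw [Nat.lt_one_iff.1 hr, Nat.lt_one_iff.1 hr']
  refine ⟨_, _, run₁.seq <| run₂.seq <| run₃.seq (RAM.Run.copy 0 10 s₃), ?_, ?_⟩
  · simp only [Polynomial.eval_add, Polynomial.eval_comp, Polynomial.eval_mul, Polynomial.eval_pow,
      Polynomial.eval_X, Polynomial.eval_ofNat, Polynomial.eval_one]
    change _ ≤ RAM.setupCmd.cost.eval S + (RAM.powCmd (2 * k)).cost.eval (2 * S + 5) +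
      RAM.searchCmd.cost.eval (2 * S + 5 + (S + 5) ^ (2 * k)) + 1
    omega
  · change _ ↔ h.SnapshotIsolation
    rw [← RAM.exec_searchCmd hk (Nat.pow_le_pow_left (by omega) _) hinv, ← hr₃ 10 (by decide)]
    rfl
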